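/- **Setting.** Let $E$ be a countable set, $(X_n)_{n\ge 0}$ the canonical process on $E^{\mathbb N_0}$, $\mathcal F_n=\sigma(X_0,\dots,X_n)$, and $\mathcal F_\infty=\sigma(X_n:n\ge0)$. Let $(\mathbb P_x)_{x\in E}$ be the laws on $(E^{\mathbb N_0},\mathcal F_\infty)$ of a Markov chain with transition probabilities $(p_{x,y})_{x,y\in E}$, i.e. $\mathbb P_x(X_0=y_0,\dots,X_k=y_k)=\mathbf 1_{y_0=x}\,p_{y_0,y_1}\cdots p_{y_{k-1},y_k}$. Assume that the chain is irreducible and recurrent and that for each $x$ only finitely many $p_{x,y}$ are nonzero. Fix a nonnegative, not identically zero stationary measure $\beta$, $\beta(y)=\sum_{x}p_{x,y}\beta(x)$ (it then never vanishes). *Measures $\mathbb Q^{x_0,\varphi}_x$.* For $x_0\in E$ and $\varphi:E\to\mathbb R_+$ with $\varphi(x_0)=0$ and $\sum_y p_{x,y}\varphi(y)=\varphi(x)$ for all $x\ne x_0$, let $\mathbb Q_x^{x_0,\varphi}$ be the unique $\sigma$-finite measure on $(E^{\mathbb N_0},\mathcal F_\infty)$ such that $\mathbb Q_x^{x_0,\varphi}(X_0\neq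 x)=0$; $\mathbb Q_x^{x_0,\varphi}(\sum_{n\ge1}\mathbf 1_{X_n=y}=\infty)=0$ for all $y\in E$; and $\mathbb Q_x^{x_0,\varphi}(F_n\mathbf 1_{\forall k\ge n,\,X_k\ne x_0})=\mathbb E_x[F_n\varphi(X_n)]$ for all $n\ge0$ and all nonnegative $\mathcal F_n$-measurable $F_n$. *Martin boundary.* For $x_0,x,y\in E$ let $G_{x_0}(x,y)$ be the $\mathbb P_x$-expectation of the number of $k\geq 0$ with $X_k=y$ and $k<\inf\{n\ge1:X_n=x_0\}$, and let $L_{x_0}(x,y)=G_{x_0}(x,y)/G_{x_0}(x_0,y)$. Fix $o\in E$ and a summable family $(w_z)_{z\in E}$ of positive reals. The Martin compactification $\overline E$ is the completion of $E$ for the distance $$\delta(x,y)=\sum_{z\in E}w_z\,\frac{|L_o(z,x)-L_o(z,y)|+|\mathbf 1_{z=x}-\mathbf 1_{z=y}|}{1+\sup_{u\in E}L_o(z,u)} ,$$ and $\partial E=\overline E\setminus E$. For all $x_0,x\in E$, $L_{x_0}(x,\cdot)$ is extended by continuity to $\overline E$. The minimal boundary $\partial_mE$ is the set of $\alpha\in\partial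 E$ such that $h:x\mapsto L_o(x,\alpha)$ is minimal harmonic for the transitions $p_{x,y}\mathbf 1_{y\ne o}$: it is nonnegative and harmonic for them, and every harmonic $g$ with $0\le g\le h$ equals $c\,h$ for some $c\in[0,1]$. For $\alpha\in\partial_mE$, put $\mathbb Q^\alpha_x=\mathbb Q^{x_1,\varphi_{x_1,\alpha}}_x$ with $\varphi_{x_1,\alpha}(x)=\frac{L_{x_1}(x,\alpha)}{\beta(x_1)}\mathbf 1_{x\ne x_1}$; this measure does not depend on the choice of $x_1\in E$ (take $x_1=o$). **Proposition.** Let $r\in(0,1)$, $x_0\in E$, $\alpha\in\partial_mE$, let $L^{x_0}_\infty$ be the total number of $n\ge0$ with $X_n=x_0$, and put, for $x\in E$, $$\psi_{x_0,\alpha,r}(x)=\frac1{\beta(x_0)}\Big[\frac r{1-r}+L_{x_0}(x,\alpha)\mathbf 1_{x\ne x_0}\Big].$$ Let $$q_{x,y}=\frac{\psi_{x_0,\alpha,r}(y)}{\psi_{x_0,\alpha,r}(x)}\,p_{x,y}\quad(x\ne x_0),\qquad q_{x_0,y}=r\,\frac{\psi_{x_0,\alpha,r}(y)}{\psi_{x_0,\alpha,r}(x_0)}\,p_{x_0,y}.$$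 Then $(q_{x,y})_{x,y\in E}$ are transition probabilities ($q_{x,y}\in[0,1]$ and $\sum_yq_{x,y}=1$), and for every $x\in E$ the measure $$\mathbb P^{x_0,\alpha,r}_x:=\frac{r^{L^{x_0}_\infty}}{\psi_{x_0,\alpha,r}(x)}\cdot\mathbb Q^\alpha_x$$ is a probability measure, namely the law of a Markov chain started at $x$ with transition probabilities $(q_{x,y})_{x,y\in E}$. -/

import Mathlib

open MeasureTheory Set Filter Topology
open scoped ENNReal

noncomputable section

/-- `μ` is the law, on the canonical space `ℕ → E`, of a Markov chain started at `x` with transition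
probabilities `p`: it is a probability measure, and the probability of following the path
`y 0, …, y k` during the first `k` steps is `𝟙_{y 0 = x} p (y 0) (y 1) ⋯ p (y (k-1)) (y k)`. -/
structure IsMarkovLaw {E : Type*} [MeasurableSpace E] (p : E → E → ℝ) (x : E)
    (μ : Measure (ℕ → E)) : Prop where
  isProbabilityMeasure : IsProbabilityMeasure μ
  start : ∀ y₀ : E, y₀ ≠ x → μ {ω | ω 0 = y₀} = 0
  path : ∀ (k : ℕ) (y : ℕ → E), y 0 = x →
    μ {ω | ∀ i ≤ k, ω i = y i} = ENNReal.ofReal (∏ i ∈ Finset.range k, p (y i) (y (i + 1)))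

/-- An irreducible recurrent Markov chain on `E` with finitely many possible jumps from each state,
given by its transition probabilities `p` and the laws `P x` of the chain started at `x`. -/
structure RecurrentChain (E : Type*) [MeasurableSpace E] where
  p : E → E → ℝ
  P : E → Measure (ℕ → E)
  p_mem : ∀ x y, p x y ∈ Icc (0 : ℝ) 1
  law : ∀ x, IsMarkovLaw p x (P x)
  finite_jumps : ∀ x, {y | p x y ≠ 0}.Finite
  irreducible : ∀ x y, ∃ n : ℕ, 0 < P x {ω | ω n = y}
  recurrent : ∀ x, P x {ω | {n : ℕ | ω n = x}.Infinite} = 1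

/-- `h` is harmonic for the (possibly substochastic) transition matrix `q`.
All matrices to which this is applied have finitely supported rows. -/
def IsHarmonic {E : Type*} (q : E → E → ℝ) (h : E → ℝ) : Prop :=
  ∀ x, ∑' y, q x y * h y = h x

/-- `h` is a minimal (nonnegative) harmonic function for `q`. -/
def IsMinimalHarmonic {E : Type*} (q : E → E → ℝ) (h : E → ℝ) : Prop :=
  IsHarmonic q h ∧ (∀ x, 0 ≤ h x) ∧
    ∀ g : E → ℝ, IsHarmonic q g → (∀ x, 0 ≤ g x ∧ g x ≤ h x) →
      ∃ c ∈ Icc (0 : ℝ) 1, ∀ x, g x = c * h x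

open Classical in
/-- `r ^ L` where `L` is the total number of times `n ≥ 0` at which the trajectory `ω` is at `x₀`
(it vanishes if `L = ∞`, for `0 ≤ r < 1`). -/
def powHits {E : Type*} (r : ℝ) (x₀ : E) (ω : ℕ → E) : ℝ≥0∞ :=
  if {n : ℕ | ω n = x₀}.Finite then ENNReal.ofReal (r ^ {n : ℕ | ω n = x₀}.ncard) else 0

namespace RecurrentChain

variable {E : Type*} [MeasurableSpace E] (C : RecurrentChain E)

/-- `β` is a nonnegative, nonzero stationary measure of the chain. -/
def IsStationary (β : E → ℝ) : Prop :=
  (∀ x, 0 ≤ β x) ∧ (∃ x, β x ≠ 0) ∧ ∀ y, HasSum (fun x => C.p x y * β x) (β y)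

/-! ### The measures `Q` attached to a function which is harmonic off a point -/

/-- The properties that characterize the measure `Q_x^{x₀, φ}`. `Filtration.piLE n` is the
`σ`-algebra generated by the coordinates `X_0, …, X_n`. -/
structure IsQ (x₀ : E) (φ : E → ℝ) (x : E) (Q : Measure (ℕ → E)) : Prop where
  sigmaFinite : SigmaFinite Q
  start : Q {ω | ω 0 ≠ x} = 0
  transient : ∀ y, Q {ω | {n : ℕ | 1 ≤ n ∧ ω n = y}.Infinite} = 0
  restrict : ∀ (n : ℕ) (F : (ℕ → E) → ℝ≥0∞),
    Measurable[Filtration.piLE (X := fun _ : ℕ => E) n] F →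
      ∫⁻ ω, F ω * {ω : ℕ → E | ∀ k ≥ n, ω k ≠ x₀}.indicator 1 ω ∂Q =
        ∫⁻ ω, F ω * ENNReal.ofReal (φ (ω n)) ∂(C.P x)

open Classical in
/-- The measure `Q_x^{x₀, φ}`: the measure with the properties `IsQ`. (It exists and is unique when
`φ ≥ 0` vanishes at `x₀` and is harmonic at all other points; the value is `0` if there is none.) -/
def Q (x₀ : E) (φ : E → ℝ) (x : E) : Measure (ℕ → E) :=
  if h : ∃ Q, C.IsQ x₀ φ x Q then h.choose else 0

/-! ### The Green function and the Martin kernel -/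

open Classical in
/-- The Green function `G_{x₀}(x, y)`: the expectation under `P x` of the number of visits to `y`
at times `k ≥ 0` which precede the first return time `inf {n ≥ 1 : X_n = x₀}`. -/
def green (x₀ x y : E) : ℝ≥0∞ :=
  ∫⁻ ω, ∑' k : ℕ, (if ω k = y ∧ ∀ j, 1 ≤ j → j ≤ k → ω j ≠ x₀ then 1 else 0) ∂(C.P x)

/-- The Martin kernel `L_{x₀}(x, y) = G_{x₀}(x, y) / G_{x₀}(x₀, y)`, for `y ∈ E`. -/
def kernel (x₀ x y : E) : ℝ := (C.green x₀ x y).toReal / (C.green x₀ x₀ y).toReal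

open Classical in
/-- The transitions `p x y 𝟙_{y ≠ x₀}` of the chain killed just before it goes to `x₀` at a
time `≥ 1`. -/
def killed (x₀ x y : E) : ℝ := if y = x₀ then 0 else C.p x y

/-! ### The Martin compactification -/

/-- The supremum `D_{x₀}(z)` of `L_{x₀}(z, ·)` (which is finite). -/
def kernelSup (x₀ z : E) : ℝ≥0∞ := ⨆ y, ENNReal.ofReal (C.kernel x₀ z y)

open Classical in
/-- The distance `∑_z w_z (|L(z,x) - L(z,y)| + |𝟙_{z=x} - 𝟙_{z=y}|) / (D(z) + 1)`, as a sum in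
`[0, ∞]`. -/
def martinDist (x₀ : E) (w : E → ℝ) (x y : E) : ℝ≥0∞ :=
  ∑' z, ENNReal.ofReal (w z) *
    ((ENNReal.ofReal |C.kernel x₀ z x - C.kernel x₀ z y| +
      ENNReal.ofReal |(if z = x then (1 : ℝ) else 0) - (if z = y then 1 else 0)|) /
      (C.kernelSup x₀ z + 1))

theorem martinDist_comm (x₀ : E) (w : E → ℝ) (x y : E) :
    C.martinDist x₀ w x y = C.martinDist x₀ w y x := by
  classical
  unfold martinDist
  refine tsum_congr fun z => ?_
  rw [abs_sub_comm (C.kernel x₀ z x), abs_sub_comm (if z = x then (1 : ℝ) else 0)]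

theorem martinDist_triangle (x₀ : E) (w : E → ℝ) (x y t : E) :
    C.martinDist x₀ w x t ≤ C.martinDist x₀ w x y + C.martinDist x₀ w y t := by
  classical
  have key : ∀ a b c : ℝ,
      ENNReal.ofReal |a - c| ≤ ENNReal.ofReal |a - b| + ENNReal.ofReal |b - c| := by
    intro a b c
    rw [← ENNReal.ofReal_add (abs_nonneg _) (abs_nonneg _)]
    exact ENNReal.ofReal_le_ofReal (abs_sub_le a b c)
  unfold martinDist
  rw [← ENNReal.tsum_add]
  refine ENNReal.tsum_le_tsum fun z => ?_
  rw [← mul_add, ← ENNReal.add_div]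
  refine mul_le_mul_right ?_ _
  refine ENNReal.div_le_div_right ?_ _
  rw [add_add_add_comm]
  exact add_le_add (key _ _ _) (key _ _ _)

/-- A copy of `E`, to be endowed with the distance `martinDist x₀ w`. -/
@[nolint unusedArguments]
def MartinSpace (_C : RecurrentChain E) (_x₀ : E) (_w : E → ℝ) : Type _ := E

instance (x₀ : E) (w : E → ℝ) : PseudoEMetricSpace (C.MartinSpace x₀ w) where
  edist x y := C.martinDist x₀ w x y
  edist_self x := by simp [martinDist]
  edist_comm x y := C.martinDist_comm x₀ w x y
  edist_triangle x y t := C.martinDist_triangle x₀ w x y t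

/-- The Martin compactification: the completion of `E` for the distance `martinDist x₀ w`.
As a topological space it does not depend on `x₀` and on the positive summable weights `w`. -/
abbrev MartinCompactification (x₀ : E) (w : E → ℝ) : Type _ :=
  UniformSpace.Completion (C.MartinSpace x₀ w)

/-- The Martin boundary: the points of the compactification that are not in `E`. -/
def boundary (x₀ : E) (w : E → ℝ) : Set (C.MartinCompactification x₀ w) :=
  (range ((↑) : C.MartinSpace x₀ w → C.MartinCompactification x₀ w))ᶜ

/-- For a point `α` of the Martin compactification (constructed with the reference point `o`) and
any `x₀ ∈ E`, the value `L_{x₀}(x, α)` of the extension by continuity of `y ↦ L_{x₀}(x, y)`. -/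
def kernelExt {o : E} {w : E → ℝ} (x₀ x : E) (α : C.MartinCompactification o w) : ℝ :=
  (UniformSpace.Completion.isDenseInducing_coe (α := C.MartinSpace o w)).extend
    (fun y : C.MartinSpace o w => C.kernel x₀ x y) α

/-- The minimal Martin boundary. -/
def minimalBoundary (o : E) (w : E → ℝ) : Set (C.MartinCompactification o w) :=
  {α | α ∈ C.boundary o w ∧ IsMinimalHarmonic (C.killed o) fun x => C.kernelExt o x α}

/-! ### The measures `Q^α` and their transforms -/

open Classical in
/-- `φ_{x₀, α}(x) = L_{x₀}(x, α) 𝟙_{x ≠ x₀} / β(x₀)`. -/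
def phi (β : E → ℝ) {o : E} {w : E → ℝ} (x₀ : E) (α : C.MartinCompactification o w) (x : E) : ℝ :=
  if x = x₀ then 0 else C.kernelExt x₀ x α / β x₀

/-- The measure `Q^α_x = Q_x^{o, φ_{o, α}}`, defined here with the reference point `o` of the
compactification; the same measure is obtained from any other point of `E`. -/
def martinQ (β : E → ℝ) {o : E} {w : E → ℝ} (α : C.MartinCompactification o w) (x : E) :
    Measure (ℕ → E) :=
  C.Q o (C.phi β o α) x

open Classical in
/-- `ψ_{x₀, α, r}(x) = (r / (1 - r) + L_{x₀}(x, α) 𝟙_{x ≠ x₀}) / β(x₀)`. -/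
def psi (β : E → ℝ) {o : E} {w : E → ℝ} (x₀ : E) (α : C.MartinCompactification o w) (r : ℝ)
    (x : E) : ℝ :=
  1 / β x₀ * (r / (1 - r) + if x = x₀ then 0 else C.kernelExt x₀ x α)

/-- The measure `r ^ L / ψ_{x₀, α, r}(x) · Q^α_x`, with `L` the total number of visits to `x₀`. -/
def transformedLaw (β : E → ℝ) {o : E} {w : E → ℝ} (x₀ : E) (α : C.MartinCompactification o w)
    (r : ℝ) (x : E) : Measure (ℕ → E) :=
  (C.martinQ β α x).withDensity fun ω => powHits r x₀ ω / ENNReal.ofReal (C.psi β x₀ α r x)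

open Classical in
/-- The transition probabilities `q_{x,y} = p_{x,y} ψ(y) / ψ(x)`, with an additional factor `r`
when `x = x₀`. -/
def transformedTransition (β : E → ℝ) {o : E} {w : E → ℝ} (x₀ : E)
    (α : C.MartinCompactification o w) (r : ℝ) (x y : E) : ℝ :=
  if x = x₀ then r * (C.psi β x₀ α r y / C.psi β x₀ α r x₀) * C.p x₀ y
  else C.psi β x₀ α r y / C.psi β x₀ α r x * C.p x y

end RecurrentChain

end

/-! Write φ = φ_{x₀,α} and c = r/((1-r)β(x₀)), so that ψ = φ + c. Because β(x₀) G_{x₀}(x₀,y) = β(y)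
(`mul_green_eq`), φ is the limit as y → α of x ↦ 𝟙_{x≠x₀} G_{x₀}(x,y)/β(y), whose Laplacian is
𝟙_{x₀}/β(x₀) - 𝟙_y/β(y). In the limit the pole y escapes, and Pφ = φ + 𝟙_{x₀}/β(x₀)
(`tsum_p_mul_phi`). As c solves r(1/β(x₀) + c) = c, the function ψ is fixed by the transition matrix
weighted by r at x₀. Hence q is a Doob transform: it is stochastic, and on F_n its law has density
r^{L_n} ψ(X_n)/ψ(x) with respect to P_x, where L_n counts the visits to x₀ before time n
(`mul_lintegral_transform`).

It remains to see that r^{L_∞}·Q^α_x has density r^{L_n} ψ(X_n) on F_n (`lintegral_powHits`). For F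
in F_n and m ≥ n, the Q^α-integral of F r^{L_m} over the event that o is not visited from time m on
is E_x[F r^{L_m} φ_{o,α}(X_m)]. The difference φ_{o,α} - φ_{x₀,α} is bounded by a Liouville argument
(`exists_abs_phi_sub_le`), and E_x[r^{L_m}] → 0 by recurrence, so this converges to the value of
E_x[F r^{L_m} ψ(X_m)], which is constant in m ≥ n. Fatou's lemma and a bound on late visits to x₀
(`lintegral_visit_le`) identify the limit with ∫ F r^{L_∞} dQ^α. The base point o of Q^α is kept
throughout, so no independence of the base point has to be proved.

As `Q` is defined by choice, its existence is needed (`exists_isQ`): with x₀ = o, Ionescu-Tulcea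
provides the law μ of the q-chain, this chain is transient because its expected numbers of visits
are finite, and ψ(x) r^{-L_∞}·μ has the characterizing properties. -/

noncomputable section

set_option linter.unusedSectionVars false

/-! ### Trajectories, the weights r ^ L, cylinders and the Markov property. -/

section CanonicalSpace

variable {E : Type*}

/-- The set of trajectories that follow `y` up to time `n`. -/
def pathCylinder (n : ℕ) (y : ℕ → E) : Set (ℕ → E) := {ω | ∀ i ≤ n, ω i = y i}

/-- The action of a nonnegative matrix on `[0, ∞]`-valued functions. -/
def matOp (m : E → E → ℝ≥0∞) (f : E → ℝ≥0∞) (x : E) : ℝ≥0∞ := ∑' y, m x y * f y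

/-- The action of a nonnegative real matrix on `[0, ∞]`-valued functions. -/
abbrev stepOp (q : E → E → ℝ) : (E → ℝ≥0∞) → E → ℝ≥0∞ := matOp fun x y => ENNReal.ofReal (q x y)

open Classical in
/-- `r ^ L`, with `L` the number of visits to `x₀` before time `n`. -/
def powHitsBefore (r : ℝ) (x₀ : E) (n : ℕ) (ω : ℕ → E) : ℝ≥0∞ :=
  ∏ i ∈ Finset.range n, if ω i = x₀ then ENNReal.ofReal r else 1

theorem matOp_mono {m : E → E → ℝ≥0∞} {f g : E → ℝ≥0∞} (h : ∀ x, f x ≤ g x) (x : E) :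
    matOp m f x ≤ matOp m g x :=
  ENNReal.tsum_le_tsum fun y => mul_le_mul_right (h y) _

theorem matOp_add (m : E → E → ℝ≥0∞) (f g : E → ℝ≥0∞) (x : E) :
    matOp m (fun y => f y + g y) x = matOp m f x + matOp m g x := by
  simp only [matOp, mul_add, ENNReal.tsum_add]

theorem matOp_const_mul (m : E → E → ℝ≥0∞) (c : ℝ≥0∞) (f : E → ℝ≥0∞) (x : E) :
    matOp m (fun y => c * f y) x = c * matOp m f x := by
  simp only [matOp, ← ENNReal.tsum_mul_left]
  exact tsum_congr fun y => by ring

theorem powHitsBefore_eq_pow {r : ℝ} (x₀ : E) (n : ℕ) (ω : ℕ → E) [DecidableEq E] :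
    powHitsBefore r x₀ n ω = ENNReal.ofReal r ^ ((Finset.range n).filter fun i => ω i = x₀).card := by
  rw [← Finset.prod_const, Finset.prod_filter, powHitsBefore]
  exact Finset.prod_congr rfl fun i _ => by congr

theorem powHitsBefore_ne_zero {r : ℝ} (hr : 0 < r) (x₀ : E) (n : ℕ) (ω : ℕ → E) :
    powHitsBefore r x₀ n ω ≠ 0 := by
  classical
  rw [powHitsBefore_eq_pow]
  exact pow_ne_zero _ (by simpa using hr)

theorem powHitsBefore_ne_top (r : ℝ) (x₀ : E) (n : ℕ) (ω : ℕ → E) :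
    powHitsBefore r x₀ n ω ≠ ∞ := by
  classical
  rw [powHitsBefore_eq_pow]
  exact ENNReal.pow_ne_top ENNReal.ofReal_ne_top

/-- After the last visit to `x₀`, `powHitsBefore` no longer moves. -/
theorem powHits_eq_powHitsBefore {r : ℝ} (hr : 0 ≤ r) {x₀ : E} {n : ℕ} {ω : ℕ → E}
    (h : ∀ k ≥ n, ω k ≠ x₀) : powHits r x₀ ω = powHitsBefore r x₀ n ω := by
  classical
  have hset : {k : ℕ | ω k = x₀} = ↑((Finset.range n).filter fun i => ω i = x₀) := by
    ext k
    simp only [mem_ofPred_eq, Finset.coe_filter, Finset.mem_range]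
    exact ⟨fun hk => ⟨by by_contra hn; exact h k (not_lt.1 hn) hk, hk⟩, fun hk => hk.2⟩
  rw [powHits, if_pos (by rw [hset]; exact Finset.finite_toSet _), powHitsBefore_eq_pow, hset,
    Set.ncard_coe_finset, ENNReal.ofReal_pow hr]

theorem finite_visits {y : E} {ω : ℕ → E} (h : {n : ℕ | 1 ≤ n ∧ ω n = y}.Finite) :
    {n : ℕ | ω n = y}.Finite := by
  refine (h.insert 0).subset fun n hn => ?_
  rcases Nat.eq_zero_or_pos n with rfl | hn0
  · exact mem_insert _ _
  · exact mem_insert_of_mem _ ⟨hn0, hn⟩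

theorem exists_forall_ge_ne_of_finite {x₀ : E} {ω : ℕ → E} (h : {k : ℕ | ω k = x₀}.Finite) :
    ∃ n, ∀ k ≥ n, ω k ≠ x₀ := by
  obtain ⟨n, hn⟩ := h.bddAbove
  exact ⟨n + 1, fun k hk hx => by have := hn hx; omega⟩

theorem tendsto_powHitsBefore {r : ℝ} (hr : r ∈ Ioo (0 : ℝ) 1) (x₀ : E) (ω : ℕ → E) :
    Tendsto (fun n => powHitsBefore r x₀ n ω) atTop (𝓝 (powHits r x₀ ω)) := by
  classical
  by_cases h : {k : ℕ | ω k = x₀}.Finite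
  · obtain ⟨n, hn⟩ := exists_forall_ge_ne_of_finite h
    refine tendsto_const_nhds.congr' ?_
    filter_upwards [eventually_ge_atTop n] with m hm
    exact powHits_eq_powHitsBefore hr.1.le fun k hk => hn k (hm.trans hk)
  · rw [powHits, if_neg h]
    simp only [powHitsBefore_eq_pow]
    refine (ENNReal.tendsto_pow_atTop_nhds_zero_of_lt_one
      (ENNReal.ofReal_lt_one.2 hr.2)).comp ?_
    refine tendsto_atTop_atTop_of_monotone (fun a b hab => Finset.card_le_card
      (Finset.filter_subset_filter _ (Finset.range_mono hab))) fun b => ?_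
    obtain ⟨t, ht, hcard⟩ := Set.Infinite.exists_subset_card_eq h b
    obtain ⟨N, hN⟩ := t.bddAbove
    refine ⟨N + 1, hcard ▸ Finset.card_le_card fun i hi => ?_⟩
    have h1 := hN hi
    simp only [Finset.mem_filter, Finset.mem_range]
    exact ⟨by omega, ht hi⟩

theorem dependsOn_powHitsBefore (r : ℝ) (x₀ : E) {n m : ℕ} (h : n ≤ m + 1) :
    DependsOn (powHitsBefore r x₀ n) (Iic m) := by
  intro ω ω' hω
  refine Finset.prod_congr rfl fun i hi => ?_
  rw [hω i (by have := Finset.mem_range.1 hi; simp only [mem_Iic]; omega)]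

theorem DependsOn.mul_fun {α : Type*} [Mul α] {F G : (ℕ → E) → α} {s : Set ℕ} (hF : DependsOn F s)
    (hG : DependsOn G s) : DependsOn (fun ω => F ω * G ω) s :=
  fun _ _ h => by simp only [hF h, hG h]

theorem DependsOn.of_le {α : Type*} {F : (ℕ → E) → α} {n m : ℕ} (hF : DependsOn F (Iic n))
    (h : n ≤ m) : DependsOn F (Iic m) :=
  fun _ _ h' => hF fun i hi => h' i (le_trans hi h)

theorem dependsOn_coord {α : Type*} (f : E → α) {k n : ℕ} (h : k ≤ n) :
    DependsOn (fun ω : ℕ → E => f (ω k)) (Iic n) :=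
  fun _ _ h' => by simp only [h' k h]

variable [Countable E] [MeasurableSpace E] [DiscreteMeasurableSpace E]

theorem DependsOn.measurable_piLE {F : (ℕ → E) → ℝ≥0∞} {n : ℕ} (hF : DependsOn F (Iic n)) :
    Measurable[Filtration.piLE (X := fun _ : ℕ => E) n] F := by
  obtain ⟨f, rfl⟩ := dependsOn_iff_exists_comp.1 hF
  exact (measurable_of_countable f).comp (comap_measurable _)

theorem DependsOn.measurable' {F : (ℕ → E) → ℝ≥0∞} {n : ℕ} (hF : DependsOn F (Iic n)) :
    Measurable F :=
  hF.measurable_piLE.mono (Filtration.le _ _) le_rfl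

theorem measurableSet_coord_eq (n : ℕ) (z : E) : MeasurableSet {ω : ℕ → E | ω n = z} := by
  change MeasurableSet ((fun ω : ℕ → E => ω n) ⁻¹' {z})
  exact measurableSet_preimage (measurable_pi_apply n) (measurableSet_singleton z)

theorem measurableSet_pathCylinder (n : ℕ) (y : ℕ → E) : MeasurableSet (pathCylinder n y) := by
  have : pathCylinder n y = ⋂ i : ℕ, ⋂ _ : i ≤ n, (fun ω : ℕ → E => ω i) ⁻¹' {y i} := by
    ext ω; simp [pathCylinder]
  rw [this]
  exact MeasurableSet.iInter fun i => MeasurableSet.iInter fun _ =>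
    (measurable_pi_apply i) (measurableSet_singleton _)

/-- Two integrals of functions of the first `n + 1` coordinates against densities agree as soon as
they agree on cylinders. -/
theorem lintegral_mul_eq_of_pathCylinder {μ ν : Measure (ℕ → E)} {g g' : (ℕ → E) → ℝ≥0∞}
    (hg : Measurable g) (hg' : Measurable g') {n : ℕ}
    (h : ∀ y, ∫⁻ ω in pathCylinder n y, g ω ∂μ = ∫⁻ ω in pathCylinder n y, g' ω ∂ν)
    {F : (ℕ → E) → ℝ≥0∞} (hF : DependsOn F (Iic n)) :
    ∫⁻ ω, F ω * g ω ∂μ = ∫⁻ ω, F ω * g' ω ∂ν := by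
  have hFm := hF.measurable'
  -- Everything is pushed to the countable space `Iic n → E`, where a measure is determined by its
  -- values on singletons, that is, on cylinders.
  obtain ⟨f, rfl⟩ := dependsOn_iff_exists_comp.1 hF
  set R : (ℕ → E) → (Iic n → E) := (Iic n).domRestrict
  have hR : Measurable R := measurable_pi_lambda _ fun i => measurable_pi_apply _
  have key : ∀ (μ : Measure (ℕ → E)) {g : (ℕ → E) → ℝ≥0∞}, Measurable g →
      ∫⁻ ω, (f ∘ R) ω * g ω ∂μ = ∫⁻ z, f z ∂((μ.withDensity g).map R) := by
    intro μ g hg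
    rw [lintegral_map (measurable_of_countable f) hR]
    change _ = ∫⁻ a, (f ∘ R) a ∂μ.withDensity g
    rw [lintegral_withDensity_eq_lintegral_mul _ hg hFm]
    simp only [Pi.mul_apply, mul_comm]
  rw [key μ hg, key ν hg']
  congr 1
  refine Measure.ext_of_singleton fun z => ?_
  -- The truncation `min i n` extends `z` to an infinite trajectory; its values after time `n` are
  -- irrelevant.
  have hz : R ⁻¹' {z} = pathCylinder n fun i => z ⟨min i n, mem_Iic.2 (min_le_right i n)⟩ := by
    ext ω
    simp only [mem_preimage, mem_singleton_iff, pathCylinder, mem_ofPred_eq]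
    constructor
    · rintro rfl i hi
      simp [R, min_eq_left hi]
    · intro hω
      ext ⟨i, hi⟩
      simpa [R, min_eq_left (mem_Iic.1 hi)] using hω i hi
  rw [Measure.map_apply hR (measurableSet_singleton _),
    Measure.map_apply hR (measurableSet_singleton _), hz,
    withDensity_apply _ (measurableSet_pathCylinder _ _),
    withDensity_apply _ (measurableSet_pathCylinder _ _), h]

theorem lintegral_coord_eq_tsum (μ : Measure (ℕ → E)) (n : ℕ) (f : E → ℝ≥0∞) :
    ∫⁻ ω, f (ω n) ∂μ = ∑' z, f z * μ {ω | ω n = z} := by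
  have := lintegral_map (μ := μ) (measurable_of_countable f)
    (measurable_pi_apply (X := fun _ : ℕ => E) n)
  rw [← this, lintegral_countable']
  refine tsum_congr fun z => ?_
  rw [Measure.map_apply (measurable_pi_apply n) (measurableSet_singleton _)]
  rfl

namespace IsMarkovLaw

variable {q : E → E → ℝ} {x : E} {μ : Measure (ℕ → E)}

theorem measure_pathCylinder (hμ : IsMarkovLaw q x μ) (hq : ∀ x y, 0 ≤ q x y) (k : ℕ) (y : ℕ → E)
    (hy : y 0 = x) :
    μ (pathCylinder k y) = ∏ i ∈ Finset.range k, ENNReal.ofReal (q (y i) (y (i + 1))) := by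
  rw [← ENNReal.ofReal_prod_of_nonneg fun i _ => hq _ _]
  exact hμ.path k y hy

theorem measure_pathCylinder_of_ne (hμ : IsMarkovLaw q x μ) (k : ℕ) (y : ℕ → E)
    (hy : y 0 ≠ x) : μ (pathCylinder k y) = 0 :=
  measure_mono_null (fun _ hω => hω 0 (Nat.zero_le _)) (hμ.start _ hy)

theorem measure_start_ne (hμ : IsMarkovLaw q x μ) : μ {ω | ω 0 ≠ x} = 0 := by
  have : {ω : ℕ → E | ω 0 ≠ x} = ⋃ y : {y : E // y ≠ x}, {ω | ω 0 = y.1} := by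
    ext ω; simp
  rw [this]
  exact measure_iUnion_null fun y => hμ.start _ y.2

theorem lintegral_start (hμ : IsMarkovLaw q x μ) (f : E → ℝ≥0∞) : ∫⁻ ω, f (ω 0) ∂μ = f x := by
  have := hμ.isProbabilityMeasure
  have h : ∀ᵐ ω ∂μ, f (ω 0) = f x := by
    filter_upwards [(measure_eq_zero_iff_ae_notMem.1 hμ.measure_start_ne)] with ω hω
    rw [not_not.1 hω]
  rw [lintegral_congr_ae h]
  simp

/-- The Markov property, at one step. -/
theorem lintegral_succ (hμ : IsMarkovLaw q x μ) (hq : ∀ x y, 0 ≤ q x y) (n : ℕ)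
    {F : (ℕ → E) → ℝ≥0∞} (hF : DependsOn F (Iic n)) (f : E → ℝ≥0∞) :
    ∫⁻ ω, F ω * f (ω (n + 1)) ∂μ = ∫⁻ ω, F ω * stepOp q f (ω n) ∂μ := by
  refine lintegral_mul_eq_of_pathCylinder
    ((measurable_of_countable f).comp (measurable_pi_apply _))
    ((measurable_of_countable (stepOp q f)).comp (measurable_pi_apply _)) (fun y => ?_) hF
  by_cases hy : y 0 = x
  · have h1 : ∫⁻ ω in pathCylinder n y, stepOp q f (ω n) ∂μ
        = stepOp q f (y n) * μ (pathCylinder n y) := by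
      rw [setLIntegral_congr_fun (g := fun _ => stepOp q f (y n)) (measurableSet_pathCylinder n y)
        fun ω hω => by simp only [hω n le_rfl], lintegral_const, Measure.restrict_apply_univ]
    change ∫⁻ ω in pathCylinder n y, f (ω (n + 1)) ∂μ =
      ∫⁻ ω in pathCylinder n y, stepOp q f (ω n) ∂μ
    rw [h1, lintegral_coord_eq_tsum]
    change _ = (∑' z, ENNReal.ofReal (q (y n) z) * f z) * _
    rw [← ENNReal.tsum_mul_right]
    refine tsum_congr fun z => ?_
    have h2 : {ω : ℕ → E | ω (n + 1) = z} ∩ pathCylinder n y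
        = pathCylinder (n + 1) (Function.update y (n + 1) z) := by
      ext ω
      simp only [mem_inter_iff, mem_ofPred_eq, pathCylinder]
      constructor
      · rintro ⟨h, h'⟩ i hi
        rcases Nat.lt_or_ge n i with hin | hin
        · obtain rfl : i = n + 1 := by omega
          simpa using h
        · rw [Function.update_of_ne (by omega), h' i hin]
      · intro h
        refine ⟨by simpa using h (n + 1) le_rfl, fun i hi => ?_⟩
        simpa [Function.update_of_ne (show i ≠ n + 1 by omega)] using h i (by omega)
    rw [Measure.restrict_apply (measurableSet_coord_eq (n + 1) z), h2, hμ.measure_pathCylinder hq _ _ (by simpa using hy),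
      hμ.measure_pathCylinder hq _ _ hy, Finset.prod_range_succ]
    have h4 : ∀ i ∈ Finset.range n, ENNReal.ofReal (q (Function.update y (n + 1) z i)
        (Function.update y (n + 1) z (i + 1))) = ENNReal.ofReal (q (y i) (y (i + 1))) := by
      intro i hi
      have := Finset.mem_range.1 hi
      rw [Function.update_of_ne (by omega), Function.update_of_ne (by omega)]
    rw [Finset.prod_congr rfl h4, Function.update_self, Function.update_of_ne (by omega)]
    ring
  · rw [Measure.restrict_eq_zero.2 (hμ.measure_pathCylinder_of_ne n y hy)]
    simp

/-- A discrete Feynman-Kac formula. -/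
theorem lintegral_prod_mul (hμ : IsMarkovLaw q x μ) (hq : ∀ x y, 0 ≤ q x y) (a b : E → ℝ≥0∞)
    (k : ℕ) (f : E → ℝ≥0∞) :
    ∫⁻ ω, (∏ i ∈ Finset.range k, (a (ω i) * b (ω (i + 1)))) * f (ω k) ∂μ =
      (matOp fun z y => a z * ENNReal.ofReal (q z y) * b y)^[k] f x := by
  induction k generalizing f with
  | zero => simpa using hμ.lintegral_start f
  | succ k ih =>
    have h1 : ∀ ω : ℕ → E, (∏ i ∈ Finset.range (k + 1), (a (ω i) * b (ω (i + 1)))) * f (ω (k + 1))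
        = ((∏ i ∈ Finset.range k, (a (ω i) * b (ω (i + 1)))) * a (ω k)) *
          (fun y => b y * f y) (ω (k + 1)) := by
      intro ω
      rw [Finset.prod_range_succ]
      ring
    have hdep : DependsOn (fun ω : ℕ → E =>
        (∏ i ∈ Finset.range k, (a (ω i) * b (ω (i + 1)))) * a (ω k)) (Iic k) := by
      intro ω ω' h
      have : ∀ i ∈ Finset.range k, a (ω i) * b (ω (i + 1)) = a (ω' i) * b (ω' (i + 1)) := by
        intro i hi
        have := Finset.mem_range.1 hi
        rw [h i (mem_Iic.2 (by omega)), h (i + 1) (mem_Iic.2 (by omega))]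
      simp only
      rw [Finset.prod_congr rfl this, h k (mem_Iic.2 le_rfl)]
    simp_rw [h1]
    rw [hμ.lintegral_succ hq k hdep fun y => b y * f y, Function.iterate_succ_apply, ← ih]
    refine lintegral_congr fun ω => ?_
    rw [mul_assoc]
    congr 1
    simp only [matOp, ← ENNReal.tsum_mul_left]
    exact tsum_congr fun y => by ring

end IsMarkovLaw

end CanonicalSpace

/-! ### Potential theory of nonnegative matrices. -/

section MatOp

variable {E : Type*}

open Classical in
/-- The indicator function of a point. -/
def pointIndicator (y z : E) : ℝ≥0∞ := if z = y then 1 else 0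

theorem matOp_pointIndicator (m : E → E → ℝ≥0∞) (x y : E) : matOp m (pointIndicator y) x = m x y := by
  classical
  simp [matOp, pointIndicator]

theorem matOp_congr {m : E → E → ℝ≥0∞} {f g : E → ℝ≥0∞} {x : E}
    (h : ∀ y, m x y ≠ 0 → f y = g y) : matOp m f x = matOp m g x := by
  refine tsum_congr fun y => ?_
  by_cases hy : m x y = 0
  · simp [hy]
  · rw [h y hy]

theorem matOp_tsum {ι : Type*} (m : E → E → ℝ≥0∞) (f : ι → E → ℝ≥0∞) (x : E) :
    matOp m (fun y => ∑' i, f i y) x = ∑' i, matOp m (f i) x := by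
  simp only [matOp, ← ENNReal.tsum_mul_left]
  exact ENNReal.tsum_comm

theorem matOp_iterate_mono {m : E → E → ℝ≥0∞} (n : ℕ) {f g : E → ℝ≥0∞} (h : ∀ x, f x ≤ g x) (x : E) :
    (matOp m)^[n] f x ≤ (matOp m)^[n] g x := by
  induction n generalizing x with
  | zero => exact h x
  | succ n ih =>
    rw [Function.iterate_succ_apply', Function.iterate_succ_apply']
    exact matOp_mono ih x

theorem matOp_iterate_add (m : E → E → ℝ≥0∞) (n : ℕ) (f g : E → ℝ≥0∞) (x : E) :
    (matOp m)^[n] (fun y => f y + g y) x = (matOp m)^[n] f x + (matOp m)^[n] g x := by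
  induction n generalizing x with
  | zero => rfl
  | succ n ih =>
    simp only [Function.iterate_succ_apply']
    rw [← matOp_add]
    exact matOp_congr fun y _ => ih y

theorem matOp_iterate_const_mul (m : E → E → ℝ≥0∞) (n : ℕ) (c : ℝ≥0∞) (f : E → ℝ≥0∞) (x : E) :
    (matOp m)^[n] (fun y => c * f y) x = c * (matOp m)^[n] f x := by
  induction n generalizing x with
  | zero => rfl
  | succ n ih =>
    simp only [Function.iterate_succ_apply']
    rw [← matOp_const_mul]
    exact matOp_congr fun y _ => ih y

/-- The iterate applied to `pointIndicator z` is a column of the `n`-th matrix power; expanding in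
columns gives access to decompositions at the last step. -/
theorem matOp_iterate_eq_tsum (m : E → E → ℝ≥0∞) (n : ℕ) (f : E → ℝ≥0∞) (x : E) :
    (matOp m)^[n] f x = ∑' z, (matOp m)^[n] (pointIndicator z) x * f z := by
  classical
  induction n generalizing x with
  | zero => simp [pointIndicator]
  | succ n ih =>
    simp only [Function.iterate_succ_apply']
    have : ∀ z, matOp m ((matOp m)^[n] (pointIndicator z)) x * f z =
        matOp m (fun y => (matOp m)^[n] (pointIndicator z) y * f z) x := by
      intro z
      simp only [mul_comm _ (f z)]
      rw [matOp_const_mul]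
    simp_rw [this]
    rw [← matOp_tsum]
    exact matOp_congr fun y _ => ih y

/-- A supersolution dominates the potential. -/
theorem tsum_matOp_iterate_le {m : E → E → ℝ≥0∞} {f g : E → ℝ≥0∞}
    (h : ∀ x, f x + matOp m g x ≤ g x) (x : E) : ∑' n, (matOp m)^[n] f x ≤ g x := by
  -- Iterate the supersolution inequality, then drop the remainder.
  have key : ∀ n, ∑ k ∈ Finset.range n, (matOp m)^[k] f x + (matOp m)^[n] g x ≤ g x := by
    intro n
    induction n with
    | zero => simp
    | succ n ih =>
      rw [Finset.sum_range_succ, add_assoc, Function.iterate_succ_apply, ← matOp_iterate_add]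
      exact (add_le_add_right (matOp_iterate_mono n h x) _).trans ih
  rw [ENNReal.tsum_eq_iSup_nat]
  exact iSup_le fun n => le_self_add.trans (key n)

theorem matOp_eq_sum {m : E → E → ℝ≥0∞} {x : E} {s : Finset E} (hs : ∀ y, m x y ≠ 0 → y ∈ s)
    (f : E → ℝ≥0∞) : matOp m f x = ∑ y ∈ s, m x y * f y :=
  tsum_eq_sum fun y hy => by
    rw [not_imp_comm.1 (hs y) hy, zero_mul]

/-- With finite rows the sum is finite, so pointwise limits pass through without any domination. -/
theorem tendsto_matOp {ι : Type*} {l : Filter ι} {m : E → E → ℝ≥0∞} {x : E}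
    (hm : {y | m x y ≠ 0}.Finite)
    (hm' : ∀ y, m x y ≠ ∞) {f : ι → E → ℝ≥0∞} {g : E → ℝ≥0∞}
    (h : ∀ y, Tendsto (fun i => f i y) l (𝓝 (g y))) :
    Tendsto (fun i => matOp m (f i) x) l (𝓝 (matOp m g x)) := by
  have hs : ∀ y, m x y ≠ 0 → y ∈ hm.toFinset := fun y hy => by simpa using hy
  simp_rw [matOp_eq_sum hs]
  exact tendsto_finsetSum _ fun y _ => ENNReal.Tendsto.const_mul (h y) (Or.inr (hm' y))

end MatOp

/-! ### The killed chain, its Green function, and consequences of recurrence. -/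

namespace RecurrentChain

variable {E : Type*} [Countable E] [MeasurableSpace E] [DiscreteMeasurableSpace E]
  (C : RecurrentChain E)

/-- The transition operator of the chain killed when it goes to `o`. -/
abbrev killedOp (o : E) : (E → ℝ≥0∞) → E → ℝ≥0∞ := stepOp (C.killed o)

theorem p_nonneg (x y : E) : 0 ≤ C.p x y := (C.p_mem x y).1

theorem finite_ofReal_p (x : E) : {y | ENNReal.ofReal (C.p x y) ≠ 0}.Finite :=
  (C.finite_jumps x).subset fun y hy h => hy (by simp [h])

theorem killed_self (o x : E) : C.killed o x o = 0 := if_pos rfl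

theorem killed_of_ne {o y : E} (h : y ≠ o) (x : E) : C.killed o x y = C.p x y := if_neg h

theorem killed_le_p (o x y : E) : C.killed o x y ≤ C.p x y := by
  rcases eq_or_ne y o with rfl | h
  · rw [killed_self]; exact C.p_nonneg _ _
  · rw [C.killed_of_ne h]

theorem finite_ofReal_killed (o x : E) : {y | ENNReal.ofReal (C.killed o x y) ≠ 0}.Finite :=
  (C.finite_ofReal_p x).subset fun y hy h => hy <| le_antisymm
    (h ▸ ENNReal.ofReal_le_ofReal (C.killed_le_p o x y)) zero_le

theorem stepOp_p_eq_add (o : E) (f : E → ℝ≥0∞) (x : E) :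
    stepOp C.p f x = C.killedOp o f x + ENNReal.ofReal (C.p x o) * f o := by
  classical
  simp only [killedOp, stepOp, matOp]
  rw [ENNReal.tsum_eq_add_tsum_ite o, add_comm]
  congr 1
  refine tsum_congr fun y => ?_
  rcases eq_or_ne y o with rfl | h
  · simp [killed_self]
  · simp [h, killed_of_ne]

theorem stepOp_p_eq_killedOp {o : E} {f : E → ℝ≥0∞} (h : f o = 0) (x : E) :
    stepOp C.p f x = C.killedOp o f x := by
  rw [C.stepOp_p_eq_add o, h, mul_zero, add_zero]

theorem killedOp_congr {o : E} {f g : E → ℝ≥0∞} (h : ∀ y, y ≠ o → f y = g y) (x : E) :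
    C.killedOp o f x = C.killedOp o g x :=
  matOp_congr fun y hy => h y fun hyo => hy (by simp [hyo, killed_self])

/-- That the rows sum to one is not part of `RecurrentChain`; it follows from the total mass of the
laws, through one Markov step. -/
theorem stepOp_one (x : E) : stepOp C.p 1 x = 1 := by
  have := (C.law x).isProbabilityMeasure
  have h := (C.law x).lintegral_succ C.p_nonneg 0 (F := fun _ => 1) (fun _ _ _ => rfl) 1
  simp only [one_mul, Pi.one_apply, lintegral_one, measure_univ] at h
  rw [(C.law x).lintegral_start (stepOp C.p 1)] at h
  exact h.symm

theorem stepOp_const (c : ℝ≥0∞) (x : E) : stepOp C.p (fun _ => c) x = c := by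
  have h : stepOp C.p (fun y => c * (1 : E → ℝ≥0∞) y) x = c * stepOp C.p 1 x :=
    matOp_const_mul _ c 1 x
  simpa only [C.stepOp_one x, Pi.one_apply, mul_one] using h

theorem killedOp_le_stepOp (o : E) (f : E → ℝ≥0∞) (x : E) :
    C.killedOp o f x ≤ stepOp C.p f x := by
  rw [C.stepOp_p_eq_add o]; exact le_self_add

-- Feynman-Kac with a weight on arrival points only: time 0 is not tested, in accordance with return
-- times being at least 1.
open Classical in
theorem killedOp_iterate_eq_lintegral (o x : E) (k : ℕ) (f : E → ℝ≥0∞) :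
    (C.killedOp o)^[k] f x =
      ∫⁻ ω, (if ∀ j, 1 ≤ j → j ≤ k → ω j ≠ o then 1 else 0) * f (ω k) ∂(C.P x) := by
  have h := (C.law x).lintegral_prod_mul C.p_nonneg 1 (fun y => if y ≠ o then 1 else 0) k f
  have h1 : (fun z y => (1 : E → ℝ≥0∞) z * ENNReal.ofReal (C.p z y) * if y ≠ o then 1 else 0) =
      fun z y => ENNReal.ofReal (C.killed o z y) := by
    ext z y
    rcases eq_or_ne y o with rfl | hy
    · simp [killed_self]
    · simp [hy, killed_of_ne]
  rw [h1] at h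
  rw [killedOp, stepOp, ← h]
  refine lintegral_congr fun ω => ?_
  congr 1
  simp only [Pi.one_apply, one_mul]
  rw [Finset.prod_ite_zero]
  simp only [Finset.mem_range, Finset.prod_const_one]
  have hiff : (∀ i, i < k → ω (i + 1) ≠ o) ↔ ∀ j, 1 ≤ j → j ≤ k → ω j ≠ o := by
    refine ⟨fun h j h1 h2 => ?_, fun h j hj => h (j + 1) (by omega) (by omega)⟩
    obtain ⟨j, rfl⟩ : ∃ i, j = i + 1 := ⟨j - 1, by omega⟩
    exact h j (by omega)
  by_cases h : ∀ j, 1 ≤ j → j ≤ k → ω j ≠ o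
  · rw [if_pos h, if_pos (hiff.2 h)]
  · rw [if_neg h, if_neg (hiff.not.2 h)]

theorem green_eq_tsum (o x y : E) :
    C.green o x y = ∑' k, (C.killedOp o)^[k] (pointIndicator y) x := by
  classical
  rw [green, lintegral_tsum]
  · refine tsum_congr fun k => ?_
    rw [killedOp_iterate_eq_lintegral]
    refine lintegral_congr fun ω => ?_
    by_cases h1 : ω k = y <;> by_cases h2 : ∀ j, 1 ≤ j → j ≤ k → ω j ≠ o <;>
      simp [h1, h2, pointIndicator]
  · intro k
    refine (DependsOn.measurable' (n := k) fun ω ω' h => ?_).aemeasurable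
    rw [h k (mem_Iic.2 le_rfl)]
    congr 2
    refine propext (forall_congr' fun j => forall_congr' fun _ => forall_congr' fun hj => ?_)
    rw [h j (mem_Iic.2 hj)]

/-- Decomposition at the first step. -/
theorem green_eq_add_killedOp (o x y : E) :
    C.green o x y = pointIndicator y x + C.killedOp o (fun z => C.green o z y) x := by
  simp only [green_eq_tsum]
  simp only [killedOp, stepOp]
  rw [matOp_tsum, tsum_eq_zero_add' ENNReal.summable]
  simp only [Function.iterate_succ_apply', Function.iterate_zero, id]

/-- Decomposition at the last step; it governs the Green function as a measure in `y`. -/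
theorem green_eq_add_tsum (o x y : E) :
    C.green o x y = pointIndicator y x +
      ∑' z, C.green o x z * ENNReal.ofReal (C.killed o z y) := by
  simp only [green_eq_tsum]
  rw [tsum_eq_zero_add' ENNReal.summable]
  congr 1
  simp_rw [← ENNReal.tsum_mul_right]
  rw [ENNReal.tsum_comm]
  refine tsum_congr fun k => ?_
  rw [Function.iterate_succ_apply, matOp_iterate_eq_tsum]
  refine tsum_congr fun z => ?_
  rw [show C.killedOp o (pointIndicator y) z = _ from matOp_pointIndicator _ z y]

theorem green_le_of_supersolution {o y : E} {g : E → ℝ≥0∞}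
    (h : ∀ x, pointIndicator y x + C.killedOp o g x ≤ g x) (x : E) : C.green o x y ≤ g x := by
  rw [green_eq_tsum]
  exact tsum_matOp_iterate_le h x

/-- The Green function is maximal at its pole. -/
theorem green_le_green_self (o x y : E) : C.green o x y ≤ C.green o y y := by
  -- The Green function truncated at its value at the pole is still a supersolution, since killing
  -- only decreases constants.
  refine (C.green_le_of_supersolution (g := fun z => min (C.green o z y) (C.green o y y))
    (fun z => ?_) x).trans (min_le_right _ _)
  have h1 : C.killedOp o (fun z => min (C.green o z y) (C.green o y y)) z ≤
      C.killedOp o (fun z => C.green o z y) z := matOp_mono (fun _ => min_le_left _ _) z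
  rcases eq_or_ne z y with rfl | hz
  · rw [min_self]
    conv_rhs => rw [C.green_eq_add_killedOp]
    exact add_le_add_right h1 _
  · have h0 : pointIndicator y z = 0 := if_neg hz
    rw [h0, zero_add]
    refine le_min ?_ ?_
    · conv_rhs => rw [C.green_eq_add_killedOp, h0, zero_add]
      exact h1
    · calc _ ≤ C.killedOp o (fun _ => C.green o y y) z := matOp_mono (fun _ => min_le_right _ _) z
        _ ≤ stepOp C.p (fun _ => C.green o y y) z := C.killedOp_le_stepOp o _ z
        _ = _ := C.stepOp_const _ _

/-- Induction along the trajectories of the chain. -/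
theorem reachable_induction {S : E → Prop} (o : E) (ho : S o)
    (h : ∀ x z, S x → 0 < C.p x z → S z) (x : E) : S x := by
  classical
  obtain ⟨n, hn⟩ := C.irreducible o x
  have h1 := (C.law o).lintegral_prod_mul C.p_nonneg 1 1 n (pointIndicator x)
  have h2 : ∫⁻ ω, pointIndicator x (ω n) ∂(C.P o) = C.P o {ω | ω n = x} := by
    rw [lintegral_coord_eq_tsum, tsum_eq_single x]
    · simp [pointIndicator]
    · intro z hz
      simp [pointIndicator, hz]
  simp only [Pi.one_apply, mul_one, one_mul, Finset.prod_const_one] at h1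
  rw [h2] at h1
  rw [h1] at hn
  clear h1 h2
  induction n generalizing o with
  | zero =>
    have : o = x := by
      by_contra hne
      simp [pointIndicator, hne] at hn
    exact this ▸ ho
  | succ n ih =>
    rw [Function.iterate_succ_apply', matOp] at hn
    obtain ⟨z, hz⟩ : ∃ z, ENNReal.ofReal (C.p o z) *
        ((stepOp C.p)^[n] (pointIndicator x)) z ≠ 0 := by
      by_contra! hne
      exact hn.ne' (ENNReal.tsum_eq_zero.2 hne)
    refine ih z (h o z ho ?_) (pos_iff_ne_zero.2 (right_ne_zero_of_mul hz))
    simpa using left_ne_zero_of_mul hz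

/-- The chain started at `x` visits `o` at a positive time. -/
theorem tendsto_killedOp_iterate_one (o x : E) :
    Tendsto (fun n => (C.killedOp o)^[n] 1 x) atTop (𝓝 0) := by
  classical
  have hle : ∀ x, C.killedOp o 1 x ≤ 1 := fun x =>
    (C.killedOp_le_stepOp o _ x).trans (C.stepOp_one x).le
  have hanti : ∀ x, Antitone fun n => (C.killedOp o)^[n] 1 x := fun x =>
    antitone_nat_of_succ_le fun n => by
      rw [Function.iterate_succ_apply]
      exact matOp_iterate_mono n hle x
  -- `v x` is the probability of no visit to `o` at a positive time. It vanishes at `o` by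
  -- recurrence, and `v = killedOp o v` spreads this zero along all possible jumps.
  set v : E → ℝ≥0∞ := fun x => ⨅ n, (C.killedOp o)^[n] 1 x
  have hv : ∀ x, Tendsto (fun n => (C.killedOp o)^[n] 1 x) atTop (𝓝 (v x)) :=
    fun x => tendsto_atTop_iInf (hanti x)
  have hfix : ∀ x, v x = C.killedOp o v x := by
    intro x
    refine tendsto_nhds_unique ((tendsto_add_atTop_iff_nat 1).2 (hv x)) ?_
    simp only [Function.iterate_succ_apply']
    exact tendsto_matOp (C.finite_ofReal_killed o x) (fun _ => ENNReal.ofReal_ne_top) hv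
  have ho : v o = 0 := by
    refine tendsto_nhds_unique (hv o) ?_
    have hprob := (C.law o).isProbabilityMeasure
    have hmeas : MeasurableSet {ω : ℕ → E | {n : ℕ | ω n = o}.Infinite} := by
      have : {ω : ℕ → E | {n : ℕ | ω n = o}.Infinite} = ⋂ N : ℕ, ⋃ n : ℕ, ⋃ _ : N ≤ n,
          {ω | ω n = o} := by
        ext ω
        simp only [mem_ofPred_eq, ← Nat.frequently_atTop_iff_infinite, frequently_atTop, mem_iInter,
          mem_iUnion, exists_prop]
      rw [this]
      exact MeasurableSet.iInter fun N => MeasurableSet.iUnion fun n =>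
        MeasurableSet.iUnion fun _ => measurableSet_coord_eq n o
    have hae : ∀ᵐ ω ∂(C.P o), {n : ℕ | ω n = o}.Infinite :=
      (prob_compl_eq_zero_iff hmeas).2 (C.recurrent o)
    simp only [killedOp_iterate_eq_lintegral, Pi.one_apply, mul_one]
    conv => arg 3; rw [← lintegral_zero (μ := C.P o)]
    refine tendsto_lintegral_of_dominated_convergence (fun _ => 1) (fun n => ?_) (fun n => ?_)
      (by simp) ?_
    · refine DependsOn.measurable' (n := n) fun ω ω' h => ?_
      congr 1
      refine propext (forall_congr' fun j => forall_congr' fun _ => forall_congr' fun hj => ?_)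
      rw [h j (mem_Iic.2 hj)]
    · refine ae_of_all _ fun ω => ?_
      dsimp only
      split_ifs <;> simp
    · filter_upwards [hae] with ω hω
      obtain ⟨j, hj, hj0⟩ := hω.exists_gt 0
      refine tendsto_const_nhds.congr' ?_
      filter_upwards [eventually_ge_atTop j] with n hn
      exact (if_neg (show ¬ ∀ i, 1 ≤ i → i ≤ n → ω i ≠ o from fun h => h j hj0 hn hj)).symm
  have hzero : ∀ x, v x = 0 := by
    refine C.reachable_induction o ho fun x z hx hxz => ?_
    rcases eq_or_ne z o with rfl | hz
    · exact ho
    · rw [hfix x] at hx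
      have := ENNReal.tsum_eq_zero.1 hx z
      simp only [C.killed_of_ne hz] at this
      simpa [hxz.not_ge] using this
  rw [← hzero x]
  exact hv x

/-- A subinvariant bounded function for the killed chain vanishes. -/
theorem eq_zero_of_le_killedOp {o : E} {d : E → ℝ≥0∞} {B : ℝ≥0∞} (hB : B ≠ ∞) (hd : ∀ x, d x ≤ B)
    (h : ∀ x, d x ≤ C.killedOp o d x) (x : E) : d x = 0 := by
  have h1 : ∀ n x, d x ≤ (C.killedOp o)^[n] d x := by
    intro n
    induction n with
    | zero => exact fun x => le_rfl
    | succ n ih =>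
      intro x
      rw [Function.iterate_succ_apply']
      exact (h x).trans (matOp_mono ih x)
  -- The factor of `B` is the probability of avoiding `o` at times 1 to `n`, which tends to 0.
  have h2 : ∀ n, d x ≤ B * (C.killedOp o)^[n] 1 x := by
    intro n
    rw [← matOp_iterate_const_mul]
    exact (h1 n x).trans (matOp_iterate_mono n (fun y => by simpa using hd y) x)
  have h3 := ENNReal.Tendsto.const_mul (C.tendsto_killedOp_iterate_one o x) (Or.inr hB)
  rw [mul_zero] at h3
  exact le_antisymm (ge_of_tendsto' h3 h2) zero_le

theorem summable_p_mul (x : E) (h : E → ℝ) : Summable fun y => C.p x y * h y :=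
  summable_of_ne_finset_zero (s := (C.finite_jumps x).toFinset) fun y hy => by
    have : C.p x y = 0 := by simpa using hy
    rw [this, zero_mul]

theorem stepOp_ofReal {h : E → ℝ} (hh : ∀ x, 0 ≤ h x) (x : E) :
    stepOp C.p (fun y => ENNReal.ofReal (h y)) x = ENNReal.ofReal (∑' y, C.p x y * h y) := by
  rw [ENNReal.ofReal_tsum_of_nonneg (fun y => mul_nonneg (C.p_nonneg x y) (hh y))
    (C.summable_p_mul x h)]
  exact tsum_congr fun y => (ENNReal.ofReal_mul (C.p_nonneg x y)).symm

theorem stepOp_ne_top {f : E → ℝ≥0∞} (hf : ∀ y, f y ≠ ∞) (x : E) : stepOp C.p f x ≠ ∞ := by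
  have : f = fun y => ENNReal.ofReal (f y).toReal := by
    ext y; rw [ENNReal.ofReal_toReal (hf y)]
  rw [this, C.stepOp_ofReal fun y => ENNReal.toReal_nonneg]
  exact ENNReal.ofReal_ne_top

theorem toReal_stepOp {f : E → ℝ≥0∞} (hf : ∀ y, f y ≠ ∞) (x : E) :
    (stepOp C.p f x).toReal = ∑' y, C.p x y * (f y).toReal := by
  have : f = fun y => ENNReal.ofReal (f y).toReal := by
    ext y; rw [ENNReal.ofReal_toReal (hf y)]
  conv_lhs => rw [this, C.stepOp_ofReal fun y => ENNReal.toReal_nonneg]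
  exact ENNReal.toReal_ofReal (tsum_nonneg fun y => mul_nonneg (C.p_nonneg x y) ENNReal.toReal_nonneg)

theorem tsum_p (x : E) : ∑' y, C.p x y = 1 := by
  have := C.toReal_stepOp (f := 1) (by simp) x
  rw [C.stepOp_one] at this
  simpa using this.symm

/-- A Liouville property: a bounded function which is harmonic off a point is constant. -/
theorem eq_of_bounded_of_harmonic_off {o : E} {h : E → ℝ} {B : ℝ} (hB : ∀ x, |h x| ≤ B)
    (hh : ∀ x, x ≠ o → ∑' y, C.p x y * h y = h x) (x : E) : h x = h o := by
  -- This `d` vanishes at `o`, so for it killing changes nothing; off `o` it is subharmonic by the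
  -- triangle inequality.
  have key := C.eq_zero_of_le_killedOp (o := o) (d := fun x => ENNReal.ofReal |h x - h o|)
    (B := ENNReal.ofReal (B + B)) ENNReal.ofReal_ne_top (fun x => ?_) (fun x => ?_) x
  · have := ENNReal.ofReal_eq_zero.1 key
    have := abs_nonpos_iff.1 this
    linarith
  · exact ENNReal.ofReal_le_ofReal ((abs_sub _ _).trans (add_le_add (hB x) (hB o)))
  · rcases eq_or_ne x o with rfl | hx
    · simp
    · rw [← C.stepOp_p_eq_killedOp (by simp), C.stepOp_ofReal fun y => abs_nonneg _]
      refine ENNReal.ofReal_le_ofReal ?_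
      have h1 : h x - h o = ∑' y, C.p x y * (h y - h o) := by
        simp_rw [mul_sub]
        rw [(C.summable_p_mul x h).tsum_sub (C.summable_p_mul x fun _ => h o), hh x hx,
          tsum_mul_right, C.tsum_p, one_mul]
      rw [h1]
      refine (norm_tsum_le_tsum_norm (C.summable_p_mul x fun y => h y - h o).norm).trans_eq ?_
      refine tsum_congr fun y => ?_
      rw [norm_mul, Real.norm_eq_abs, Real.norm_eq_abs, abs_of_nonneg (C.p_nonneg x y)]

open Classical in
/-- The transitions weighted by `r` at `x₀`. -/
def weighted (r : ℝ) (x₀ x y : E) : ℝ≥0∞ :=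
  (if x = x₀ then ENNReal.ofReal r else 1) * ENNReal.ofReal (C.p x y)

theorem matOp_weighted [DecidableEq E] (r : ℝ) (x₀ : E) (f : E → ℝ≥0∞) (x : E) :
    matOp (C.weighted r x₀) f x = (if x = x₀ then ENNReal.ofReal r else 1) * stepOp C.p f x := by
  simp only [matOp, ← ENNReal.tsum_mul_left, weighted, mul_assoc]
  refine tsum_congr fun y => ?_
  congr

theorem lintegral_powHitsBefore_mul (r : ℝ) (x₀ x : E) (n : ℕ) (f : E → ℝ≥0∞) :
    ∫⁻ ω, powHitsBefore r x₀ n ω * f (ω n) ∂(C.P x) = (matOp (C.weighted r x₀))^[n] f x := by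
  classical
  have h := (C.law x).lintegral_prod_mul C.p_nonneg
    (fun y => if y = x₀ then ENNReal.ofReal r else 1) 1 n f
  simp only [Pi.one_apply, mul_one] at h
  exact h

/-- The chain visits `x₀` infinitely often. -/
theorem tendsto_lintegral_powHitsBefore {r : ℝ} (hr : r ∈ Ioo (0 : ℝ) 1) (x₀ x : E) :
    Tendsto (fun n => ∫⁻ ω, powHitsBefore r x₀ n ω ∂(C.P x)) atTop (𝓝 0) := by
  classical
  have heq : ∀ n x, ∫⁻ ω, powHitsBefore r x₀ n ω ∂(C.P x) =
      (matOp (C.weighted r x₀))^[n] 1 x := by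
    intro n x
    rw [← C.lintegral_powHitsBefore_mul]
    simp
  simp_rw [heq]
  have hr1 : ENNReal.ofReal r < 1 := ENNReal.ofReal_lt_one.2 hr.2
  have hle : ∀ x, matOp (C.weighted r x₀) 1 x ≤ 1 := by
    intro x
    rw [C.matOp_weighted, C.stepOp_one, mul_one]
    split_ifs
    · exact hr1.le
    · exact le_rfl
  have hanti : ∀ x, Antitone fun n => (matOp (C.weighted r x₀))^[n] 1 x := fun x =>
    antitone_nat_of_succ_le fun n => by
      rw [Function.iterate_succ_apply]
      exact matOp_iterate_mono n hle x
  -- `ρ` is fixed by the weighted matrix, hence bounded and harmonic off `x₀`, hence constant; at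
  -- `x₀` the fixed point equation reads `ρ = r ρ`, so the constant is 0.
  set ρ : E → ℝ≥0∞ := fun x => ⨅ n, (matOp (C.weighted r x₀))^[n] 1 x
  have hρ : ∀ x, Tendsto (fun n => (matOp (C.weighted r x₀))^[n] 1 x) atTop (𝓝 (ρ x)) :=
    fun x => tendsto_atTop_iInf (hanti x)
  have hfix : ∀ x, ρ x = matOp (C.weighted r x₀) ρ x := by
    intro x
    refine tendsto_nhds_unique ((tendsto_add_atTop_iff_nat 1).2 (hρ x)) ?_
    simp only [Function.iterate_succ_apply']
    refine tendsto_matOp ((C.finite_ofReal_p x).subset fun y hy =>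
      right_ne_zero_of_mul (show C.weighted r x₀ x y ≠ 0 from hy))
      (fun y => ENNReal.mul_ne_top ?_ ENNReal.ofReal_ne_top) hρ
    split_ifs
    · exact ENNReal.ofReal_ne_top
    · exact ENNReal.one_ne_top
  have hρ1 : ∀ x, ρ x ≤ 1 := fun x => iInf_le (fun n => (matOp (C.weighted r x₀))^[n] 1 x) 0
  have hρtop : ∀ x, ρ x ≠ ∞ := fun x => ((hρ1 x).trans_lt ENNReal.one_lt_top).ne
  have hconst : ∀ x, ρ x = ρ x₀ := by
    intro x
    have h := C.eq_of_bounded_of_harmonic_off (o := x₀) (h := fun x => (ρ x).toReal) (B := 1)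
      (fun x => ?_) (fun x hx => ?_) x
    · exact (ENNReal.toReal_eq_toReal_iff' (hρtop x) (hρtop x₀)).1 h
    · rw [abs_of_nonneg ENNReal.toReal_nonneg]
      exact ENNReal.toReal_le_of_le_ofReal zero_le_one (by simpa using hρ1 x)
    · rw [← C.toReal_stepOp hρtop]
      congr 1
      conv_rhs => rw [hfix x, C.matOp_weighted, if_neg hx, one_mul]
  have hx₀ : ρ x₀ = 0 := by
    have h := hfix x₀
    rw [C.matOp_weighted, if_pos rfl, show ρ = fun _ => ρ x₀ from funext hconst,
      C.stepOp_const] at h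
    by_contra hne
    have h2 := ENNReal.mul_lt_mul_left hne (hρtop x₀) hr1
    rw [one_mul] at h2
    exact absurd h h2.ne'
  have := hρ x
  rwa [hconst x, hx₀] at this

end RecurrentChain

/-! ### The stationary measure and the Green function. -/

namespace RecurrentChain

variable {E : Type*} [Countable E] [MeasurableSpace E] [DiscreteMeasurableSpace E]
  (C : RecurrentChain E)

namespace IsStationary

variable {C} {β : E → ℝ}

theorem pos (hβ : C.IsStationary β) (x : E) : 0 < β x := by
  obtain ⟨h0, ⟨o, ho⟩, hs⟩ := hβ
  refine C.reachable_induction (S := fun x => 0 < β x) o ((h0 o).lt_of_ne ho.symm)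
    (fun x z hx hxz => ?_) x
  exact (mul_pos hxz hx).trans_le
    (le_hasSum (hs z) x fun y _ => mul_nonneg (C.p_nonneg y z) (h0 y))

theorem tsum_ofReal (hβ : C.IsStationary β) (y : E) :
    ∑' x, ENNReal.ofReal (β x) * ENNReal.ofReal (C.p x y) = ENNReal.ofReal (β y) := by
  rw [← (hβ.2.2 y).tsum_eq, ENNReal.ofReal_tsum_of_nonneg
    (fun x => mul_nonneg (C.p_nonneg x y) (hβ.1 x)) (hβ.2.2 y).summable]
  exact tsum_congr fun x => by rw [ENNReal.ofReal_mul (C.p_nonneg x y), mul_comm]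

/-- Off `o`, stationarity bounds the mass arriving at `y` from the first `n` steps of an excursion
by `β y`; at `o` the killed chain never arrives and only the initial term is left. The induction is
on the number of steps, splitting off the last one. -/
theorem mul_green_le (hβ : C.IsStationary β) (o y : E) :
    ENNReal.ofReal (β o) * C.green o o y ≤ ENNReal.ofReal (β y) := by
  have key : ∀ n y, ENNReal.ofReal (β o) *
      ∑ k ∈ Finset.range n, (C.killedOp o)^[k] (pointIndicator y) o ≤ ENNReal.ofReal (β y) := by
    intro n
    induction n with
    | zero => simp
    | succ n ih =>
      intro y
      rw [Finset.sum_range_succ']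
      have h1 : ∀ k, (C.killedOp o)^[k + 1] (pointIndicator y) o =
          ∑' z, (C.killedOp o)^[k] (pointIndicator z) o * ENNReal.ofReal (C.killed o z y) := by
        intro k
        rw [Function.iterate_succ_apply, matOp_iterate_eq_tsum]
        refine tsum_congr fun z => ?_
        rw [show C.killedOp o (pointIndicator y) z = _ from matOp_pointIndicator _ z y]
      simp_rw [h1]
      rw [← Summable.tsum_finsetSum fun _ _ => ENNReal.summable]
      simp_rw [← Finset.sum_mul]
      rw [mul_add, ← ENNReal.tsum_mul_left]
      simp_rw [← mul_assoc]
      rcases eq_or_ne y o with rfl | hy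
      · simp [killed_self, pointIndicator]
      · have h2 : pointIndicator y o = 0 := if_neg hy.symm
        simp only [Function.iterate_zero, id, h2, mul_zero, add_zero, C.killed_of_ne hy]
        rw [← hβ.tsum_ofReal y]
        exact ENNReal.tsum_le_tsum fun z => mul_le_mul_left (ih z) _
  rw [green_eq_tsum, ENNReal.tsum_eq_iSup_nat, ENNReal.mul_iSup]
  exact iSup_le fun n => key n y

/-- Comparison with `β` gives finiteness at `x = o`, and an infinite value at `z` would make the
value infinite at every `x` that can jump to `z ≠ o`. -/
theorem green_ne_top (hβ : C.IsStationary β) (o x y : E) : C.green o x y ≠ ∞ := by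
  refine C.reachable_induction (S := fun x => C.green o x y ≠ ∞) o ?_ (fun x z hx hxz => ?_) x
  · intro h
    have := hβ.mul_green_le o y
    rw [h, ENNReal.mul_top (by simpa using hβ.pos o)] at this
    exact absurd this (by simp)
  · rcases eq_or_ne z o with rfl | hz
    · intro h
      have := hβ.mul_green_le z y
      rw [h, ENNReal.mul_top (by simpa using hβ.pos z)] at this
      exact absurd this (by simp)
    · intro h
      refine hx ?_
      rw [C.green_eq_add_killedOp]
      have h1 : ENNReal.ofReal (C.killed o x z) * C.green o z y ≤
          C.killedOp o (fun z => C.green o z y) x :=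
        ENNReal.le_tsum (f := fun z => ENNReal.ofReal (C.killed o x z) * C.green o z y) z
      rw [h, C.killed_of_ne hz, ENNReal.mul_top (by simpa using hxz)] at h1
      rw [top_le_iff.1 h1, add_top]

/-- The excursion measure formula for the stationary measure. -/
theorem mul_green_eq (hβ : C.IsStationary β) (o y : E) :
    ENNReal.ofReal (β o) * C.green o o y = ENNReal.ofReal (β y) := by
  classical
  -- The return to `o`, decomposed according to the point from which it occurs, has probability one.
  have hreturn : ∑' z, C.green o o z * ENNReal.ofReal (C.p z o) = 1 := by
    have h1 : ∀ k, (C.killedOp o)^[k] (fun z => ENNReal.ofReal (C.p z o)) o +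
        (C.killedOp o)^[k + 1] 1 o = (C.killedOp o)^[k] 1 o := by
      intro k
      rw [Function.iterate_succ_apply, killedOp, stepOp, ← matOp_iterate_add]
      refine congrFun (congrArg ((matOp _)^[k]) (funext fun z => ?_)) o
      have := C.stepOp_p_eq_add o 1 z
      rw [C.stepOp_one] at this
      simp only [Pi.one_apply, mul_one] at this ⊢
      rw [this, add_comm]
    have h2 : ∀ n, ∑ k ∈ Finset.range n,
        (C.killedOp o)^[k] (fun z => ENNReal.ofReal (C.p z o)) o + (C.killedOp o)^[n] 1 o = 1 := by
      intro n
      induction n with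
      | zero => simp
      | succ n ih => rw [Finset.sum_range_succ, add_assoc, h1, ih]
    have h3 : ∑' z, C.green o o z * ENNReal.ofReal (C.p z o) =
        ∑' k, (C.killedOp o)^[k] (fun z => ENNReal.ofReal (C.p z o)) o := by
      simp_rw [green_eq_tsum, ← ENNReal.tsum_mul_right]
      rw [ENNReal.tsum_comm]
      exact tsum_congr fun k => (matOp_iterate_eq_tsum _ _ _ _).symm
    rw [h3]
    have h4 := (ENNReal.summable (f := fun k =>
      (C.killedOp o)^[k] (fun z => ENNReal.ofReal (C.p z o)) o)).hasSum.tendsto_sum_nat.add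
      (C.tendsto_killedOp_iterate_one o o)
    simp_rw [h2, add_zero] at h4
    exact tendsto_nhds_unique h4 tendsto_const_nhds
  -- `γ` is stationary, below `β`, and equal to it at `o`. A strict inequality at one point would
  -- propagate along the jumps to `o`.
  set γ : E → ℝ≥0∞ := fun y => ENNReal.ofReal (β o) * C.green o o y
  have hγo : γ o = ENNReal.ofReal (β o) := by
    simp only [γ]
    rw [C.green_eq_add_tsum]
    simp [killed_self, pointIndicator]
  have hγ : ∀ y, ∑' z, γ z * ENNReal.ofReal (C.p z y) = γ y := by
    intro y
    simp only [γ, mul_assoc, ENNReal.tsum_mul_left]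
    rcases eq_or_ne y o with rfl | hy
    · rw [hreturn, mul_one]; exact hγo.symm
    · conv_rhs => rw [C.green_eq_add_tsum]
      rw [show pointIndicator y o = 0 from if_neg hy.symm, zero_add]
      simp only [C.killed_of_ne hy]
  have hle : ∀ y, γ y ≤ ENNReal.ofReal (β y) := hβ.mul_green_le o
  refine le_antisymm (hle y) ?_
  by_contra! hlt
  have := C.reachable_induction (S := fun z => γ z < ENNReal.ofReal (β z)) y hlt
    (fun x z hx hxz => ?_) o
  · exact this.ne hγo
  · rw [← hγ z, ← hβ.tsum_ofReal z]
    refine ENNReal.tsum_lt_tsum (i := x) ?_ (fun a => mul_le_mul_left (hle a) _) ?_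
    · rw [hγ z]
      exact ((hle z).trans_lt ENNReal.ofReal_lt_top).ne
    · exact ENNReal.mul_lt_mul_left (by simpa using hxz) ENNReal.ofReal_ne_top hx

theorem toReal_green (hβ : C.IsStationary β) (o y : E) :
    (C.green o o y).toReal = β y / β o := by
  have h := congrArg ENNReal.toReal (hβ.mul_green_eq o y)
  rw [ENNReal.toReal_mul, ENNReal.toReal_ofReal (hβ.1 o), ENNReal.toReal_ofReal (hβ.1 y)] at h
  rw [eq_div_iff (hβ.pos o).ne', mul_comm, h]

end IsStationary

end RecurrentChain

/-! ### Existence of Markov laws. -/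

/-- A Markov chain with given stochastic transition matrix exists (Ionescu-Tulcea). -/
theorem exists_isMarkovLaw {E : Type*} [Countable E] [MeasurableSpace E]
    [DiscreteMeasurableSpace E] {q : E → E → ℝ} (hq : ∀ x y, 0 ≤ q x y)
    (hq1 : ∀ x, HasSum (q x) 1) (x : E) : ∃ μ : Measure (ℕ → E), IsMarkovLaw q x μ := by
  classical
  have hsum : ∀ x, HasSum (fun y => ENNReal.ofReal (q x y)) 1 := fun x => by
    rw [← ENNReal.ofReal_one, ← (hq1 x).tsum_eq,
      ENNReal.ofReal_tsum_of_nonneg (hq x) (hq1 x).summable]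
    exact ENNReal.summable.hasSum
  let ν : E → PMF E := fun x => ⟨fun y => ENNReal.ofReal (q x y), hsum x⟩
  let κ : (n : ℕ) → ProbabilityTheory.Kernel (Finset.Iic n → E) E := fun n =>
    ⟨fun z => (ν (z ⟨n, Finset.mem_Iic.2 le_rfl⟩)).toMeasure, measurable_of_countable _⟩
  have : ∀ n, ProbabilityTheory.IsMarkovKernel (κ n) := fun n =>
    ⟨fun z => by change IsProbabilityMeasure (PMF.toMeasure _); infer_instance⟩
  let X : ℕ → Type _ := fun _ => E
  let μ := ProbabilityTheory.Kernel.traj (X := X) κ 0 (fun _ => x)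
  have hR : ∀ (n : ℕ) (y : ℕ → E), (Preorder.frestrictLe (π := X) n) ⁻¹'
      {Preorder.frestrictLe (π := X) n y} = {ω | ∀ i ≤ n, ω i = y i} := by
    intro n y
    ext ω
    simp only [mem_preimage, mem_singleton_iff, mem_ofPred_eq]
    refine ⟨fun h i hi => congrFun h ⟨i, Finset.mem_Iic.2 hi⟩, fun h => ?_⟩
    ext ⟨i, hi⟩
    exact h i (Finset.mem_Iic.1 hi)
  have hmap : ∀ (n : ℕ) (y : ℕ → E), μ {ω | ∀ i ≤ n, ω i = y i} =
      ProbabilityTheory.Kernel.partialTraj (X := X) κ 0 n (fun _ => x)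
        {Preorder.frestrictLe (π := X) n y} := by
    intro n y
    rw [← ProbabilityTheory.Kernel.traj_map_frestrictLe_apply, Measure.map_apply
      (Preorder.measurable_frestrictLe (X := X) n) (measurableSet_singleton _), hR]
  have h0 : ∀ y : ℕ → E, μ {ω | ∀ i ≤ 0, ω i = y i} = if y 0 = x then 1 else 0 := by
    intro y
    rw [hmap, ProbabilityTheory.Kernel.partialTraj_self, ProbabilityTheory.Kernel.id_apply,
      Measure.dirac_apply' _ (measurableSet_singleton _)]
    simp only [indicator, mem_singleton_iff, Pi.one_apply]
    refine if_congr ⟨fun h => (congrFun h ⟨0, Finset.mem_Iic.2 le_rfl⟩).symm, fun h => ?_⟩ rfl rfl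
    ext ⟨i, hi⟩
    obtain rfl : i = 0 := by simpa using hi
    exact h.symm
  have hstep : ∀ (k : ℕ) (y : ℕ → E), μ {ω | ∀ i ≤ k + 1, ω i = y i} =
      μ {ω | ∀ i ≤ k, ω i = y i} * ENNReal.ofReal (q (y k) (y (k + 1))) := by
    intro k y
    have h1 := congrArg (fun m => m ({Preorder.frestrictLe (π := X) k y} ×ˢ {y (k + 1)}))
      (ProbabilityTheory.Kernel.partialTraj_compProd_eq_map_traj (X := X) (κ := κ)
        (Nat.zero_le k) (x₀ := fun _ => x))
    rw [Measure.compProd_apply_prod (measurableSet_singleton _) (measurableSet_singleton _),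
      lintegral_singleton, ← hmap, Measure.map_apply (by fun_prop)
        ((measurableSet_singleton _).prod (measurableSet_singleton _))] at h1
    have h2 : κ k (Preorder.frestrictLe (π := X) k y) {y (k + 1)} =
        ENNReal.ofReal (q (y k) (y (k + 1))) := by
      change PMF.toMeasure _ _ = _
      rw [PMF.toMeasure_apply_singleton _ _ (measurableSet_singleton _)]
      rfl
    rw [h2, mul_comm] at h1
    rw [h1]
    change μ _ = μ _
    congr 1
    rw [← hR, mk_preimage_prod]
    ext ω
    simp only [mem_preimage, mem_singleton_iff, mem_inter_iff]
    constructor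
    · intro h
      refine ⟨?_, congrFun h ⟨k + 1, Finset.mem_Iic.2 le_rfl⟩⟩
      ext ⟨i, hi⟩
      exact congrFun h ⟨i, Finset.mem_Iic.2 (by have := Finset.mem_Iic.1 hi; omega)⟩
    · rintro ⟨h, h'⟩
      ext ⟨i, hi⟩
      rcases Nat.lt_or_ge k i with hik | hik
      · obtain rfl : i = k + 1 := by have := Finset.mem_Iic.1 hi; omega
        exact h'
      · exact congrFun h ⟨i, Finset.mem_Iic.2 hik⟩
  refine ⟨μ, ⟨inferInstance, fun y₀ hy₀ => ?_, fun k y hy => ?_⟩⟩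
  · have := h0 fun _ => y₀
    simp only [nonpos_iff_eq_zero, forall_eq, if_neg hy₀] at this
    exact this
  · rw [ENNReal.ofReal_prod_of_nonneg fun i _ => hq _ _]
    induction k with
    | zero => rw [h0, if_pos hy]; simp
    | succ k ih => rw [hstep, ih, Finset.prod_range_succ]

/-! ### Avoiding a point, and first visits. -/

section CanonicalSpace

variable {E : Type*}

open Classical in
/-- The indicator of the event that `x₀` is not visited at the times `n ≤ k < m`. -/
def avoidBetween (x₀ : E) (n m : ℕ) (ω : ℕ → E) : ℝ≥0∞ :=
  if ∀ k, n ≤ k → k < m → ω k ≠ x₀ then 1 else 0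

theorem avoidBetween_le_one (x₀ : E) (n m : ℕ) (ω : ℕ → E) : avoidBetween x₀ n m ω ≤ 1 := by
  rw [avoidBetween]; split_ifs <;> simp

theorem avoidBetween_self (x₀ : E) (n : ℕ) (ω : ℕ → E) : avoidBetween x₀ n n ω = 1 :=
  if_pos fun _ h1 h2 => absurd h2 h1.not_gt

theorem dependsOn_avoidBetween (x₀ : E) (n : ℕ) {m l : ℕ} (h : m ≤ l + 1) :
    DependsOn (avoidBetween x₀ n m) (Iic l) := by
  intro ω ω' hω
  rw [avoidBetween, avoidBetween]
  congr 1
  refine propext (forall_congr' fun k => forall_congr' fun _ => forall_congr' fun hk => ?_)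
  rw [hω k (mem_Iic.2 (by omega))]

theorem tendsto_avoidBetween (x₀ : E) (n : ℕ) (ω : ℕ → E) :
    Tendsto (fun m => avoidBetween x₀ n m ω) atTop
      (𝓝 ({ω : ℕ → E | ∀ k ≥ n, ω k ≠ x₀}.indicator 1 ω)) := by
  classical
  by_cases h : ∀ k ≥ n, ω k ≠ x₀
  · rw [indicator_of_mem (show ω ∈ {ω : ℕ → E | ∀ k ≥ n, ω k ≠ x₀} from h)]
    refine tendsto_const_nhds.congr fun m => ?_
    exact (if_pos fun k hk _ => h k hk).symm
  · rw [indicator_of_notMem (show ω ∉ {ω : ℕ → E | ∀ k ≥ n, ω k ≠ x₀} from h)]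
    push Not at h
    obtain ⟨k, hk, hkx⟩ := h
    refine tendsto_const_nhds.congr' ?_
    filter_upwards [eventually_gt_atTop k] with m hm
    exact (if_neg fun h' => h' k hk hm hkx).symm

open Classical in
/-- The indicator of a visit to `x₀` is the sum over the possible times of the first visit. -/
theorem tsum_first_visit (x₀ : E) (m : ℕ) (ω : ℕ → E) :
    ∑' i, avoidBetween x₀ m (m + i) ω * pointIndicator x₀ (ω (m + i)) =
      if ∃ k ≥ m, ω k = x₀ then 1 else 0 := by
  split_ifs with h
  · have h' : ∃ i, ω (m + i) = x₀ := by
      obtain ⟨k, hk, hkx⟩ := h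
      exact ⟨k - m, by rwa [Nat.add_sub_cancel' hk]⟩
    rw [tsum_eq_single (Nat.find h')]
    · have h1 : avoidBetween x₀ m (m + Nat.find h') ω = 1 := if_pos fun k h1 h2 => by
        have := Nat.find_min h' (m := k - m) (by omega)
        rwa [Nat.add_sub_cancel' h1] at this
      rw [h1, pointIndicator, if_pos (Nat.find_spec h'), one_mul]
    · intro i hi
      rcases lt_or_gt_of_ne hi with hlt | hgt
      · rw [pointIndicator, if_neg (Nat.find_min h' hlt), mul_zero]
      · have h1 : avoidBetween x₀ m (m + i) ω = 0 :=
          if_neg fun h1 => h1 (m + Nat.find h') (by omega) (by omega) (Nat.find_spec h')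
        rw [h1, zero_mul]
  · refine ENNReal.tsum_eq_zero.2 fun i => ?_
    rw [pointIndicator, if_neg fun hi => h ⟨m + i, by omega, hi⟩, mul_zero]

variable [Countable E] [MeasurableSpace E] [DiscreteMeasurableSpace E]

theorem measurable_powHits {r : ℝ} (hr : r ∈ Ioo (0 : ℝ) 1) (x₀ : E) :
    Measurable (powHits (E := E) r x₀) :=
  measurable_of_tendsto_metrizable
    (fun n => (dependsOn_powHitsBefore r x₀ n.le_succ).measurable')
    (tendsto_pi_nhds.2 (tendsto_powHitsBefore hr x₀))

theorem measurable_avoid (x₀ : E) (n : ℕ) :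
    Measurable ({ω : ℕ → E | ∀ k ≥ n, ω k ≠ x₀}.indicator (1 : (ℕ → E) → ℝ≥0∞)) :=
  measurable_of_tendsto_metrizable
    (fun m => (dependsOn_avoidBetween x₀ n m.le_succ).measurable')
    (tendsto_pi_nhds.2 (tendsto_avoidBetween x₀ n))

theorem measurable_mul_avoid {F : (ℕ → E) → ℝ≥0∞} (hF : Measurable F) (x₀ : E) (n : ℕ) :
    Measurable fun ω => F ω * {ω : ℕ → E | ∀ k ≥ n, ω k ≠ x₀}.indicator 1 ω :=
  hF.mul (measurable_avoid x₀ n)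

theorem dependsOn_indicator_pathCylinder (n : ℕ) (y : ℕ → E) :
    DependsOn ((pathCylinder n y).indicator (1 : (ℕ → E) → ℝ≥0∞)) (Iic n) := by
  classical
  intro ω ω' hω
  simp only [indicator, Pi.one_apply]
  refine if_congr (forall_congr' fun i => forall_congr' fun hi => ?_) rfl rfl
  rw [hω i hi]

end CanonicalSpace

/-! ### The Doob transform for the weighted matrix, and its transience. -/

namespace RecurrentChain

variable {E : Type*} [Countable E] [MeasurableSpace E] [DiscreteMeasurableSpace E]
  (C : RecurrentChain E)

/-- The weight before time `m + 1` involves only `X_0, …, X_m`, so it can be put into the past in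
the Markov property; its last factor is the weight of the matrix at `X_m`. -/
theorem lintegral_mul_powHitsBefore_succ (r : ℝ) (x₀ x : E) {m : ℕ} {F : (ℕ → E) → ℝ≥0∞}
    (hF : DependsOn F (Iic m)) (f : E → ℝ≥0∞) :
    ∫⁻ ω, F ω * (powHitsBefore r x₀ (m + 1) ω * f (ω (m + 1))) ∂(C.P x) =
      ∫⁻ ω, F ω * (powHitsBefore r x₀ m ω * matOp (C.weighted r x₀) f (ω m)) ∂(C.P x) := by
  classical
  have hdep := (hF.mul_fun (dependsOn_powHitsBefore r x₀ le_rfl) :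
    DependsOn (fun ω => F ω * powHitsBefore r x₀ (m + 1) ω) (Iic m))
  have h := (C.law x).lintegral_succ C.p_nonneg m hdep f
  simp only [mul_assoc] at h
  rw [h]
  refine lintegral_congr fun ω => ?_
  rw [C.matOp_weighted, powHitsBefore, Finset.prod_range_succ, mul_assoc]
  rfl

/-- The change of measure between the chain and its transform, on `F_n`. -/
theorem mul_lintegral_transform {r : ℝ} {x₀ : E} {φ : E → ℝ≥0∞} {c : ℝ≥0∞} {q : E → E → ℝ}
    (hq : ∀ x y, 0 ≤ q x y)
    (hqψ : ∀ x y, (φ x + c) * ENNReal.ofReal (q x y) = C.weighted r x₀ x y * (φ y + c))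
    {x : E} {μ : Measure (ℕ → E)} (hμ : IsMarkovLaw q x μ) (n : ℕ) {F : (ℕ → E) → ℝ≥0∞}
    (hF : DependsOn F (Iic n)) :
    (φ x + c) * ∫⁻ ω, F ω ∂μ =
      ∫⁻ ω, F ω * (powHitsBefore r x₀ n ω * (φ (ω n) + c)) ∂(C.P x) := by
  have hm : Measurable fun ω : ℕ → E => powHitsBefore r x₀ n ω * (φ (ω n) + c) :=
    (DependsOn.mul_fun (dependsOn_powHitsBefore r x₀ n.le_succ)
      (dependsOn_coord (fun y => φ y + c) le_rfl)).measurable'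
  -- Along a path the ratios of `φ + c` telescope and the factors `r` accumulate.
  have hprod : ∀ (n : ℕ) (y : ℕ → E),
      (φ (y 0) + c) * ∏ i ∈ Finset.range n, ENNReal.ofReal (q (y i) (y (i + 1))) =
        powHitsBefore r x₀ n y * (φ (y n) + c) *
          ∏ i ∈ Finset.range n, ENNReal.ofReal (C.p (y i) (y (i + 1))) := by
    intro n y
    induction n with
    | zero => simp [powHitsBefore]
    | succ n ih =>
      rw [Finset.prod_range_succ, ← mul_assoc, ih]
      calc _ = powHitsBefore r x₀ n y *
            (∏ i ∈ Finset.range n, ENNReal.ofReal (C.p (y i) (y (i + 1)))) *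
            ((φ (y n) + c) * ENNReal.ofReal (q (y n) (y (n + 1)))) := by ring
        _ = _ := by
          rw [hqψ, weighted]
          simp only [powHitsBefore, Finset.prod_range_succ]
          ring
  have key := lintegral_mul_eq_of_pathCylinder (μ := μ) (ν := C.P x) (g := fun _ => φ x + c)
    measurable_const hm (n := n) (fun y => ?_) hF
  · rw [← key, lintegral_mul_const _ hF.measurable', mul_comm]
  · have hc : ∫⁻ ω in pathCylinder n y, powHitsBefore r x₀ n ω * (φ (ω n) + c) ∂(C.P x) =
        ∫⁻ _ in pathCylinder n y, powHitsBefore r x₀ n y * (φ (y n) + c) ∂(C.P x) := by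
      refine setLIntegral_congr_fun (measurableSet_pathCylinder n y) fun ω hω => ?_
      have := dependsOn_powHitsBefore r x₀ n.le_succ (x := ω) (y := y) fun i hi => hω i hi
      simp only [this, hω n le_rfl]
    rw [hc]
    rw [setLIntegral_const, setLIntegral_const]
    by_cases hy : y 0 = x
    · rw [hμ.measure_pathCylinder hq n y hy, (C.law x).measure_pathCylinder C.p_nonneg n y hy, ← hy]
      exact hprod n y
    · rw [hμ.measure_pathCylinder_of_ne n y hy, (C.law x).measure_pathCylinder_of_ne n y hy,
        mul_zero, mul_zero]

/-- `φ` vanishes at `x₀` and is harmonic elsewhere, with mass `a` at `x₀`; `c` is the constant for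
which `φ + c` is harmonic for the transitions weighted by `r` at `x₀`. -/
structure IsPotential (r : ℝ) (x₀ : E) (φ : E → ℝ≥0∞) (c : ℝ≥0∞) : Prop where
  ne_top : ∀ x, φ x ≠ ∞
  zero : φ x₀ = 0
  harmonic : ∀ x, x ≠ x₀ → stepOp C.p φ x = φ x
  const_ne_zero : c ≠ 0
  const_ne_top : c ≠ ∞
  const_eq : ENNReal.ofReal r * (stepOp C.p φ x₀ + c) = c

namespace IsPotential

variable {C} {r : ℝ} {x₀ : E} {φ : E → ℝ≥0∞} {c : ℝ≥0∞}

/-- At `x₀`, `const_eq` says that the factor `r` exactly absorbs the excess `stepOp C.p φ x₀`. -/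
theorem matOp_weighted_eq (h : C.IsPotential r x₀ φ c) (x : E) :
    matOp (C.weighted r x₀) (fun y => φ y + c) x = φ x + c := by
  classical
  rw [C.matOp_weighted]
  have h1 : stepOp C.p (fun y => φ y + c) x = stepOp C.p φ x + c := by
    have := matOp_add (fun x y => ENNReal.ofReal (C.p x y)) φ (fun _ => c) x
    rw [show matOp (fun x y => ENNReal.ofReal (C.p x y)) (fun _ => c) x = c from
      C.stepOp_const c x] at this
    exact this
  rw [h1]
  split_ifs with hx
  · rw [hx, h.const_eq, h.zero, zero_add]
  · rw [h.harmonic x hx, one_mul]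

/-- The martingale `r ^ L_m (φ + c)(X_m)`. -/
theorem lintegral_martingale (h : C.IsPotential r x₀ φ c) (x : E) {n m : ℕ} (hnm : n ≤ m)
    {F : (ℕ → E) → ℝ≥0∞} (hF : DependsOn F (Iic n)) :
    ∫⁻ ω, F ω * (powHitsBefore r x₀ m ω * (φ (ω m) + c)) ∂(C.P x) =
      ∫⁻ ω, F ω * (powHitsBefore r x₀ n ω * (φ (ω n) + c)) ∂(C.P x) := by
  induction m, hnm using Nat.le_induction with
  | base => rfl
  | succ m hnm ih =>
    rw [← ih, C.lintegral_mul_powHitsBefore_succ r x₀ x (hF.of_le hnm) fun y => φ y + c]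
    simp only [h.matOp_weighted_eq]

/-- Up to the factor `(φ y + c) / (φ x + c)`, the expected number of visits to `y` is the potential
of the weighted matrix, which is dominated by an explicit supersolution built from the Green
function killed at `x₀`. Borel-Cantelli then yields transience. -/
theorem tsum_measure_ne_top (h : C.IsPotential r x₀ φ c) (hr : r ∈ Ioo (0 : ℝ) 1)
    (hG : ∀ x y, C.green x₀ x y ≠ ∞) {q : E → E → ℝ} (hq : ∀ x y, 0 ≤ q x y)
    (hqψ : ∀ x y, (φ x + c) * ENNReal.ofReal (q x y) = C.weighted r x₀ x y * (φ y + c))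
    {x : E} {μ : Measure (ℕ → E)} (hμ : IsMarkovLaw q x μ) (y : E) :
    ∑' n, μ {ω | ω n = y} ≠ ∞ := by
  classical
  have hψ0 : ∀ z, φ z + c ≠ 0 := fun z hz => h.const_ne_zero (add_eq_zero.1 hz).2
  have hψt : ∀ z, φ z + c ≠ ∞ := fun z => ENNReal.add_ne_top.2 ⟨h.ne_top z, h.const_ne_top⟩
  have h1 : ∀ n, (φ x + c) * μ {ω | ω n = y} =
      (φ y + c) * (matOp (C.weighted r x₀))^[n] (pointIndicator y) x := by
    intro n
    have h2 := C.mul_lintegral_transform hq hqψ hμ n (dependsOn_coord (pointIndicator y) le_rfl)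
    have h3 : ∫⁻ ω, pointIndicator y (ω n) ∂μ = μ {ω | ω n = y} := by
      rw [lintegral_coord_eq_tsum, tsum_eq_single y]
      · simp [pointIndicator]
      · intro z hz
        simp [pointIndicator, hz]
    rw [← h3, h2, ← C.lintegral_powHitsBefore_mul, ← lintegral_const_mul]
    · refine lintegral_congr fun ω => ?_
      by_cases hω : ω n = y
      · simp [pointIndicator, hω, mul_comm]
      · simp [pointIndicator, hω]
    · exact (DependsOn.mul_fun (dependsOn_powHitsBefore r x₀ n.le_succ)
        (dependsOn_coord (pointIndicator y) le_rfl)).measurable'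
  have hr1 : ENNReal.ofReal r < 1 := ENNReal.ofReal_lt_one.2 hr.2
  -- `d = G / (1 - r)`, the geometric sum over excursions from `x₀` with weight `r` for each new
  -- one.
  obtain ⟨d, hd, hdt⟩ : ∃ d : ℝ≥0∞, C.green x₀ x₀ y + ENNReal.ofReal r * d ≤ d ∧ d ≠ ∞ := by
    obtain ⟨g, hg, hgG⟩ : ∃ g : ℝ, 0 ≤ g ∧ C.green x₀ x₀ y = ENNReal.ofReal g :=
      ⟨_, ENNReal.toReal_nonneg, (ENNReal.ofReal_toReal (hG x₀ y)).symm⟩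
    have hr' : 0 < 1 - r := sub_pos.2 hr.2
    refine ⟨ENNReal.ofReal (g / (1 - r)), ?_, ENNReal.ofReal_ne_top⟩
    rw [hgG, ← ENNReal.ofReal_mul hr.1.le,
      ← ENNReal.ofReal_add hg (by have := hr.1; positivity)]
    refine ENNReal.ofReal_le_ofReal (le_of_eq ?_)
    field_simp
    ring
  set G : E → ℝ≥0∞ := fun z => if z = x₀ then 0 else C.green x₀ z y
  have hsuper : ∀ z, pointIndicator y z +
      matOp (C.weighted r x₀) (fun z => G z + d) z ≤ G z + d := by
    intro z
    have h4 : stepOp C.p (fun z => G z + d) z = C.killedOp x₀ (fun z => C.green x₀ z y) z + d := by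
      have := matOp_add (fun x y => ENNReal.ofReal (C.p x y)) G (fun _ => d) z
      rw [show matOp (fun x y => ENNReal.ofReal (C.p x y)) (fun _ => d) z = d from
        C.stepOp_const d z] at this
      refine this.trans ?_
      congr 1
      refine (C.stepOp_p_eq_killedOp (if_pos rfl) z).trans ?_
      exact C.killedOp_congr (fun y hy => if_neg hy) z
    rw [C.matOp_weighted, h4]
    have h5 := C.green_eq_add_killedOp x₀ z y
    by_cases hz : z = x₀
    · subst hz
      simp only [G, if_true, zero_add]
      refine le_trans ?_ hd
      rw [h5, mul_add, ← add_assoc]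
      gcongr
      exact mul_le_of_le_one_left' hr1.le
    · simp only [G, if_neg hz, one_mul]
      rw [h5, add_assoc]
  have hfin : (φ x + c) * ∑' n, μ {ω | ω n = y} ≠ ∞ := by
    rw [← ENNReal.tsum_mul_left]
    simp_rw [h1]
    rw [ENNReal.tsum_mul_left]
    refine ENNReal.mul_ne_top (hψt y) (ne_top_of_le_ne_top ?_ (tsum_matOp_iterate_le hsuper x))
    refine ENNReal.add_ne_top.2 ⟨?_, hdt⟩
    simp only [G]
    split_ifs
    · simp
    · exact hG _ _
  intro htop
  rw [htop, ENNReal.mul_top (hψ0 x)] at hfin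
  exact hfin rfl

end IsPotential

end RecurrentChain

/-! ### Existence of the measures Q, and the density of r ^ L · Q on F_n. -/

namespace RecurrentChain

variable {E : Type*} [Countable E] [MeasurableSpace E] [DiscreteMeasurableSpace E]
  (C : RecurrentChain E)

namespace IsPotential

variable {C} {r : ℝ} {x₀ : E} {φ : E → ℝ≥0∞} {c : ℝ≥0∞}

/-- The martingale `φ(X_m)` up to the next visit to `x₀`. -/
theorem lintegral_avoidBetween (h : C.IsPotential r x₀ φ c) (x : E) {n m : ℕ} (hnm : n ≤ m)
    {F : (ℕ → E) → ℝ≥0∞} (hF : DependsOn F (Iic n)) :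
    ∫⁻ ω, F ω * avoidBetween x₀ n m ω * (powHitsBefore r x₀ m ω * φ (ω m)) ∂(C.P x) =
      ∫⁻ ω, F ω * (powHitsBefore r x₀ n ω * φ (ω n)) ∂(C.P x) := by
  classical
  induction m, hnm using Nat.le_induction with
  | base => simp only [avoidBetween_self, mul_one]
  | succ m hnm ih =>
    rw [← ih, C.lintegral_mul_powHitsBefore_succ r x₀ x
      ((hF.of_le hnm).mul_fun (dependsOn_avoidBetween x₀ n le_rfl))]
    refine lintegral_congr fun ω => ?_
    rw [C.matOp_weighted]
    -- If `X_m = x₀`, both sides vanish: the left one by the indicator, the right one because `φ x₀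
    -- = 0`.
    by_cases hω : ω m = x₀
    · have h0 : avoidBetween x₀ n (m + 1) ω = 0 :=
        if_neg fun h => h m hnm (Nat.lt_succ_self m) hω
      rw [h0, hω, h.zero]
      simp
    · have h1 : avoidBetween x₀ n (m + 1) ω = avoidBetween x₀ n m ω := by
        rw [avoidBetween, avoidBetween]
        congr 1
        refine propext ⟨fun h k hk hkm => h k hk (by omega), fun h k hk hkm => ?_⟩
        rcases Nat.lt_succ_iff_lt_or_eq.1 hkm with h' | rfl
        · exact h k hk h'
        · exact hω
      rw [h1, if_neg hω, one_mul, h.harmonic _ hω]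

/-- Under the transformed law, the conditional probability of not visiting `x₀` any more. -/
theorem mul_lintegral_avoid (h : C.IsPotential r x₀ φ c) (hr : r ∈ Ioo (0 : ℝ) 1)
    {q : E → E → ℝ} (hq : ∀ x y, 0 ≤ q x y)
    (hqψ : ∀ x y, (φ x + c) * ENNReal.ofReal (q x y) = C.weighted r x₀ x y * (φ y + c))
    {x : E} {μ : Measure (ℕ → E)} (hμ : IsMarkovLaw q x μ) (n : ℕ) {F : (ℕ → E) → ℝ≥0∞}
    (hF : DependsOn F (Iic n)) :
    ∫⁻ ω, F ω * ((φ x + c) * {ω : ℕ → E | ∀ k ≥ n, ω k ≠ x₀}.indicator 1 ω) ∂μ =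
      ∫⁻ ω, F ω * (powHitsBefore r x₀ n ω * φ (ω n)) ∂(C.P x) := by
  have := hμ.isProbabilityMeasure
  refine lintegral_mul_eq_of_pathCylinder ((measurable_avoid x₀ n).const_mul _)
    (DependsOn.mul_fun (dependsOn_powHitsBefore r x₀ n.le_succ)
      (dependsOn_coord φ le_rfl)).measurable' (fun y => ?_) hF
  -- Passing to cylinders replaces `F` by a bounded function, as dominated convergence requires.
  set A : (ℕ → E) → ℝ≥0∞ := (pathCylinder n y).indicator 1
  have hA : DependsOn A (Iic n) := dependsOn_indicator_pathCylinder n y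
  have hA1 : ∀ ω, A ω ≤ 1 := fun ω => indicator_le_self' (by simp) ω
  have hset : ∀ (ν : Measure (ℕ → E)) (g : (ℕ → E) → ℝ≥0∞),
      ∫⁻ ω in pathCylinder n y, g ω ∂ν = ∫⁻ ω, A ω * g ω ∂ν := by
    intro ν g
    rw [← lintegral_indicator (measurableSet_pathCylinder n y)]
    refine lintegral_congr fun ω => ?_
    by_cases hω : ω ∈ pathCylinder n y <;> simp [A, hω]
  rw [hset, hset]
  have hlim1 : Tendsto (fun m => (φ x + c) * ∫⁻ ω, A ω * avoidBetween x₀ n m ω ∂μ) atTop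
      (𝓝 (∫⁻ ω, A ω * ((φ x + c) * {ω : ℕ → E | ∀ k ≥ n, ω k ≠ x₀}.indicator 1 ω) ∂μ)) := by
    have h1 : ∫⁻ ω, A ω * ((φ x + c) * {ω : ℕ → E | ∀ k ≥ n, ω k ≠ x₀}.indicator 1 ω) ∂μ =
        (φ x + c) * ∫⁻ ω, A ω * {ω : ℕ → E | ∀ k ≥ n, ω k ≠ x₀}.indicator 1 ω ∂μ := by
      rw [← lintegral_const_mul _ (measurable_mul_avoid hA.measurable' x₀ n)]
      exact lintegral_congr fun ω => by ring
    rw [h1]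
    refine ENNReal.Tendsto.const_mul ?_
      (Or.inr (ENNReal.add_ne_top.2 ⟨h.ne_top x, h.const_ne_top⟩))
    refine tendsto_lintegral_of_dominated_convergence (fun _ => 1) (fun m => ?_) (fun m => ?_)
      (by simp) ?_
    · exact hA.measurable'.mul (dependsOn_avoidBetween x₀ n m.le_succ).measurable'
    · exact ae_of_all _ fun ω => mul_le_one' (hA1 ω) (avoidBetween_le_one _ _ _ _)
    · exact ae_of_all _ fun ω => ENNReal.Tendsto.const_mul (tendsto_avoidBetween x₀ n ω)
        (Or.inr ((hA1 ω).trans_lt ENNReal.one_lt_top).ne)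
  -- After the change of measure at time `m`, the `φ` part is constant in `m ≥ n` and the `c` part
  -- is at most `c` times the expectation of `r ^ L_m`, which tends to 0.
  have hlim2 : Tendsto (fun m => (φ x + c) * ∫⁻ ω, A ω * avoidBetween x₀ n m ω ∂μ) atTop
      (𝓝 (∫⁻ ω, A ω * (powHitsBefore r x₀ n ω * φ (ω n)) ∂(C.P x))) := by
    have h2 : ∀ m, ∫⁻ ω, A ω * avoidBetween x₀ n m ω * (powHitsBefore r x₀ m ω * c) ∂(C.P x) ≤
        c * ∫⁻ ω, powHitsBefore r x₀ m ω ∂(C.P x) := by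
      intro m
      rw [← lintegral_const_mul _ (dependsOn_powHitsBefore r x₀ m.le_succ).measurable']
      refine lintegral_mono fun ω => ?_
      rw [mul_comm c]
      exact mul_le_of_le_one_left' (mul_le_one' (hA1 ω) (avoidBetween_le_one _ _ _ _))
    have h3 : Tendsto (fun m => ∫⁻ ω, A ω * avoidBetween x₀ n m ω *
        (powHitsBefore r x₀ m ω * c) ∂(C.P x)) atTop (𝓝 0) := by
      have := ENNReal.Tendsto.const_mul (C.tendsto_lintegral_powHitsBefore hr x₀ x)
        (Or.inr h.const_ne_top)
      rw [mul_zero] at this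
      exact tendsto_of_tendsto_of_tendsto_of_le_of_le tendsto_const_nhds this
        (fun _ => zero_le) h2
    have h4 := (tendsto_const_nhds (x := ∫⁻ ω, A ω * (powHitsBefore r x₀ n ω * φ (ω n)) ∂(C.P x))
      (f := atTop (α := ℕ))).add h3
    rw [add_zero] at h4
    refine h4.congr' ?_
    filter_upwards [eventually_ge_atTop n] with m hm
    have hdep : DependsOn (fun ω => A ω * avoidBetween x₀ n m ω) (Iic m) :=
      (hA.of_le hm).mul_fun (dependsOn_avoidBetween x₀ n m.le_succ)
    rw [C.mul_lintegral_transform hq hqψ hμ m hdep, ← h.lintegral_avoidBetween x hm hA,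
      ← lintegral_add_left]
    · refine lintegral_congr fun ω => ?_
      ring
    · exact (hdep.mul_fun (DependsOn.mul_fun (dependsOn_powHitsBefore r x₀ m.le_succ)
        (dependsOn_coord φ le_rfl))).measurable'
  exact tendsto_nhds_unique hlim1 hlim2

/-- Existence of the measure `Q_x^{x₀, φ}`. -/
theorem exists_isQ {φ : E → ℝ} (h : C.IsPotential r x₀ (fun x => ENNReal.ofReal (φ x)) c)
    (hr : r ∈ Ioo (0 : ℝ) 1)
    (hG : ∀ x y, C.green x₀ x y ≠ ∞) {q : E → E → ℝ} (hq : ∀ x y, 0 ≤ q x y)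
    (hq1 : ∀ x, HasSum (q x) 1)
    (hqψ : ∀ x y, (ENNReal.ofReal (φ x) + c) * ENNReal.ofReal (q x y) =
      C.weighted r x₀ x y * (ENNReal.ofReal (φ y) + c)) (x : E) :
    ∃ Q, C.IsQ x₀ φ x Q := by
  obtain ⟨μ, hμ⟩ := exists_isMarkovLaw hq hq1 x
  have := hμ.isProbabilityMeasure
  have htrans : ∀ y, μ {ω | {n : ℕ | 1 ≤ n ∧ ω n = y}.Infinite} = 0 := by
    intro y
    refine measure_mono_null ?_
      (measure_setOfPred_frequently_eq_zero (h.tsum_measure_ne_top hr hG hq hqψ hμ y))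
    intro ω hω
    exact Nat.frequently_atTop_iff_infinite.2 (hω.mono fun n hn => hn.2)
  -- Transience makes this density finite almost everywhere, whence σ-finiteness.
  set D : (ℕ → E) → ℝ≥0∞ := fun ω => (ENNReal.ofReal (φ x) + c) * (powHits r x₀ ω)⁻¹
  have hD : Measurable D := (measurable_powHits hr x₀).inv.const_mul _
  have hac : μ.withDensity D ≪ μ := withDensity_absolutelyContinuous _ _
  refine ⟨μ.withDensity D, ⟨?_, hac hμ.measure_start_ne, fun y => hac (htrans y), fun n F hF => ?_⟩⟩
  · refine SigmaFinite.withDensity_of_ne_top ?_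
    filter_upwards [measure_eq_zero_iff_ae_notMem.1 (htrans x₀)] with ω hω
    refine ENNReal.mul_ne_top (ENNReal.add_ne_top.2 ⟨h.ne_top x, h.const_ne_top⟩)
      (ENNReal.inv_ne_top.2 ?_)
    obtain ⟨n, hn⟩ := exists_forall_ge_ne_of_finite (finite_visits (not_infinite.1 hω))
    rw [powHits_eq_powHitsBefore hr.1.le hn]
    exact powHitsBefore_ne_zero hr.1 _ _ _
  · have hFd : DependsOn F (Iic n) := hF.dependsOn_of_piLE
    have hFm : Measurable F := hFd.measurable'
    rw [lintegral_withDensity_eq_lintegral_mul _ hD (measurable_mul_avoid hFm x₀ n)]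
    -- When `x₀` is avoided from time `n` on, the density involves only the weight before `n`, so it
    -- can be moved into the test function.
    have hF' : DependsOn (fun ω => F ω * (powHitsBefore r x₀ n ω)⁻¹) (Iic n) :=
      hFd.mul_fun fun ω ω' hω => by simp only [dependsOn_powHitsBefore r x₀ n.le_succ hω]
    have key := h.mul_lintegral_avoid hr hq hqψ hμ n hF'
    refine Eq.trans (lintegral_congr fun ω => ?_) (key.trans (lintegral_congr fun ω => ?_))
    · by_cases hω : ω ∈ {ω : ℕ → E | ∀ k ≥ n, ω k ≠ x₀}
      · simp only [Pi.mul_apply, indicator_of_mem hω, Pi.one_apply, mul_one, D]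
        rw [powHits_eq_powHitsBefore hr.1.le hω]
        ring
      · simp only [Pi.mul_apply, indicator_of_notMem hω, mul_zero]
    · rw [mul_assoc, ← mul_assoc _ _ (ENNReal.ofReal _), ENNReal.inv_mul_cancel
        (powHitsBefore_ne_zero hr.1 _ _ _) (powHitsBefore_ne_top _ _ _ _), one_mul]

end IsPotential

namespace IsQ

variable {C} {o x : E} {φ : E → ℝ} {Q : Measure (ℕ → E)}

theorem ae_finite_visits (hQ : C.IsQ o φ x Q) (y : E) : ∀ᵐ ω ∂Q, {n : ℕ | ω n = y}.Finite := by
  filter_upwards [measure_eq_zero_iff_ae_notMem.1 (hQ.transient y)] with ω hω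
  exact finite_visits (not_infinite.1 hω)

/-- A bound for the event that `x₀` is visited after the last visit to `o`. -/
theorem lintegral_visit_le (hQ : C.IsQ o φ x Q) (x₀ : E) (m : ℕ) {F : (ℕ → E) → ℝ≥0∞}
    (hF : DependsOn F (Iic m)) :
    ∫⁻ ω, F ω * {ω : ℕ → E | ∀ k ≥ m, ω k ≠ o}.indicator 1 ω *
        (∑' i, avoidBetween x₀ m (m + i) ω * pointIndicator x₀ (ω (m + i))) ∂Q ≤
      ENNReal.ofReal (φ x₀) * ∫⁻ ω, F ω ∂(C.P x) := by
  have hdep : ∀ i, DependsOn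
      (fun ω => F ω * (avoidBetween x₀ m (m + i) ω * pointIndicator x₀ (ω (m + i))))
      (Iic (m + i)) := fun i =>
    (hF.of_le (Nat.le_add_right m i)).mul_fun ((dependsOn_avoidBetween x₀ m
      (Nat.le_succ _)).mul_fun (dependsOn_coord (pointIndicator x₀) le_rfl))
  have h1 : ∀ i, ∫⁻ ω, F ω * {ω : ℕ → E | ∀ k ≥ m, ω k ≠ o}.indicator 1 ω *
      (avoidBetween x₀ m (m + i) ω * pointIndicator x₀ (ω (m + i))) ∂Q ≤
      ENNReal.ofReal (φ x₀) * ∫⁻ ω, F ω *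
        (avoidBetween x₀ m (m + i) ω * pointIndicator x₀ (ω (m + i))) ∂(C.P x) := by
    intro i
    rw [← lintegral_const_mul _ (hdep i).measurable']
    -- Avoiding `o` from time `m` on implies avoiding it from `m + i` on; `restrict` at time `m + i`
    -- then produces `φ x₀`, as the trajectory is at `x₀` at that time.
    refine le_trans (lintegral_mono fun ω => ?_)
      ((hQ.restrict (m + i) _ (hdep i).measurable_piLE).trans_le (lintegral_mono fun ω => ?_))
    · rw [mul_right_comm]
      refine mul_le_mul_right ?_ _
      refine indicator_le_indicator_of_subset (f := (1 : (ℕ → E) → ℝ≥0∞)) ?_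
        (fun _ => zero_le) ω
      exact fun ω hω k hk => hω k (le_trans (Nat.le_add_right m i) hk)
    · by_cases hω : ω (m + i) = x₀
      · rw [hω, mul_comm]
      · simp [pointIndicator, hω]
  simp_rw [← ENNReal.tsum_mul_left]
  rw [lintegral_tsum fun i => ?_]
  · refine (ENNReal.tsum_le_tsum h1).trans ?_
    rw [ENNReal.tsum_mul_left, ← lintegral_tsum fun i => (hdep i).measurable'.aemeasurable]
    refine mul_le_mul_right (lintegral_mono fun ω => ?_) _
    rw [ENNReal.tsum_mul_left, tsum_first_visit]
    refine mul_le_of_le_one_right' ?_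
    split_ifs <;> simp
  · exact ((hF.measurable'.mul (measurable_avoid o m)).mul
      ((dependsOn_avoidBetween x₀ m (Nat.le_succ _)).mul_fun
        (dependsOn_coord (pointIndicator x₀) le_rfl)).measurable').aemeasurable

/-- The density of `r ^ L • Q` on `F_n`, when `φ` differs by a bounded function from a potential
based at `x₀`. -/
theorem lintegral_powHits (hQ : C.IsQ o φ x Q) {r : ℝ} (hr : r ∈ Ioo (0 : ℝ) 1) {x₀ : E}
    {φ' : E → ℝ≥0∞} {c : ℝ≥0∞} (h : C.IsPotential r x₀ φ' c) {B : ℝ≥0∞} (hB : B ≠ ∞)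
    (h1 : ∀ y, ENNReal.ofReal (φ y) ≤ φ' y + B) (h2 : ∀ y, φ' y ≤ ENNReal.ofReal (φ y) + B)
    (n : ℕ) {F : (ℕ → E) → ℝ≥0∞} (hF : DependsOn F (Iic n)) (hF1 : ∀ ω, F ω ≤ 1) :
    ∫⁻ ω, F ω * powHits r x₀ ω ∂Q =
      ∫⁻ ω, F ω * (powHitsBefore r x₀ n ω * (φ' (ω n) + c)) ∂(C.P x) := by
  set N := ∫⁻ ω, F ω * (powHitsBefore r x₀ n ω * (φ' (ω n) + c)) ∂(C.P x)
  set ε : ℕ → ℝ≥0∞ := fun m => ∫⁻ ω, powHitsBefore r x₀ m ω ∂(C.P x)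
  have hε : Tendsto ε atTop (𝓝 0) := C.tendsto_lintegral_powHitsBefore hr x₀ x
  have hw : ∀ m, Measurable (powHitsBefore (E := E) r x₀ m) := fun m =>
    (dependsOn_powHitsBefore r x₀ m.le_succ).measurable'
  have hFw : ∀ m ≥ n, DependsOn (fun ω => F ω * powHitsBefore r x₀ m ω) (Iic m) := fun m hm =>
    (hF.of_le hm).mul_fun (dependsOn_powHitsBefore r x₀ m.le_succ)
  set R : ℕ → ℝ≥0∞ := fun m =>
    ∫⁻ ω, F ω * powHitsBefore r x₀ m ω * {ω : ℕ → E | ∀ k ≥ m, ω k ≠ o}.indicator 1 ω ∂Q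
  have hR : ∀ m ≥ n, R m =
      ∫⁻ ω, F ω * powHitsBefore r x₀ m ω * ENNReal.ofReal (φ (ω m)) ∂(C.P x) := fun m hm =>
    hQ.restrict m _ (hFw m hm).measurable_piLE
  have hFε : ∀ m, ∫⁻ ω, F ω * powHitsBefore r x₀ m ω ∂(C.P x) ≤ ε m := fun m =>
    lintegral_mono fun ω => mul_le_of_le_one_left' (hF1 ω)
  have hRN : ∀ m ≥ n, R m ≤ N + B * ε m := by
    intro m hm
    rw [hR m hm]
    calc _ ≤ ∫⁻ ω, (F ω * (powHitsBefore r x₀ m ω * (φ' (ω m) + c)) +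
          B * (F ω * powHitsBefore r x₀ m ω)) ∂(C.P x) := by
          refine lintegral_mono fun ω => ?_
          calc _ ≤ F ω * powHitsBefore r x₀ m ω * (φ' (ω m) + c + B) := by
                gcongr
                exact (h1 _).trans (by gcongr; exact le_self_add)
            _ = _ := by ring
      _ = N + B * ∫⁻ ω, F ω * powHitsBefore r x₀ m ω ∂(C.P x) := by
          rw [lintegral_add_right _ ((hFw m hm).measurable'.const_mul B),
            h.lintegral_martingale x hm hF, lintegral_const_mul _ (hFw m hm).measurable']
      _ ≤ _ := by gcongr; exact hFε m
  have hNR : ∀ m ≥ n, N ≤ R m + (B + c) * ε m := by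
    intro m hm
    rw [hR m hm]
    calc N = ∫⁻ ω, F ω * (powHitsBefore r x₀ m ω * (φ' (ω m) + c)) ∂(C.P x) :=
          (h.lintegral_martingale x hm hF).symm
      _ ≤ ∫⁻ ω, (F ω * powHitsBefore r x₀ m ω * ENNReal.ofReal (φ (ω m)) +
          (B + c) * (F ω * powHitsBefore r x₀ m ω)) ∂(C.P x) := by
          refine lintegral_mono fun ω => ?_
          calc _ ≤ F ω * (powHitsBefore r x₀ m ω * (ENNReal.ofReal (φ (ω m)) + B + c)) := by
                gcongr
                exact h2 _
            _ = _ := by ring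
      _ = ∫⁻ ω, F ω * powHitsBefore r x₀ m ω * ENNReal.ofReal (φ (ω m)) ∂(C.P x) +
          (B + c) * ∫⁻ ω, F ω * powHitsBefore r x₀ m ω ∂(C.P x) := by
          rw [lintegral_add_right _ ((hFw m hm).measurable'.const_mul _),
            lintegral_const_mul _ (hFw m hm).measurable']
      _ ≤ _ := by gcongr; exact hFε m
  have hlim : ∀ a : ℝ≥0∞, a ≠ ∞ → ∀ b, Tendsto (fun m => b + a * ε m) atTop (𝓝 b) := by
    intro a ha b
    have := (ENNReal.Tendsto.const_mul hε (Or.inr ha)).const_add b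
    simpa using this
  refine le_antisymm ?_ ?_
  -- Fatou: almost every trajectory eventually leaves `o`, so the integrands of `R m` converge to `F
  -- · r ^ L`.
  · calc ∫⁻ ω, F ω * powHits r x₀ ω ∂Q ≤ ∫⁻ ω, liminf (fun m => F ω * powHitsBefore r x₀ m ω *
          {ω : ℕ → E | ∀ k ≥ m, ω k ≠ o}.indicator 1 ω) atTop ∂Q := by
          refine lintegral_mono_ae ?_
          filter_upwards [hQ.ae_finite_visits o] with ω hω
          obtain ⟨k, hk⟩ := exists_forall_ge_ne_of_finite hω
          have ht : Tendsto (fun m => F ω * powHitsBefore r x₀ m ω *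
              {ω : ℕ → E | ∀ k ≥ m, ω k ≠ o}.indicator 1 ω) atTop
              (𝓝 (F ω * powHits r x₀ ω)) := by
            refine (ENNReal.Tendsto.const_mul (tendsto_powHitsBefore hr x₀ ω)
              (Or.inr ((hF1 ω).trans_lt ENNReal.one_lt_top).ne)).congr' ?_
            filter_upwards [eventually_ge_atTop k] with m hm
            rw [indicator_of_mem (show ω ∈ {ω : ℕ → E | ∀ k ≥ m, ω k ≠ o} from
              fun l hl => hk l (le_trans hm hl)), Pi.one_apply, mul_one]
          exact ht.liminf_eq.ge
      _ ≤ liminf R atTop := lintegral_liminf_le fun m =>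
          (hF.measurable'.mul (hw m)).mul (measurable_avoid o m)
      _ ≤ liminf (fun m => N + B * ε m) atTop := by
          refine liminf_le_liminf ?_
          filter_upwards [eventually_ge_atTop n] with m hm using hRN m hm
      _ = N := (hlim B hB N).liminf_eq
  · set I := ∫⁻ ω, F ω * powHits r x₀ ω ∂Q
    -- Without a visit to `x₀` from time `m` on, the weight before `m` is already `r ^ L`; the other
    -- trajectories are handled by `lintegral_visit_le`.
    have hRI : ∀ m ≥ n, R m ≤ I + ENNReal.ofReal (φ x₀) * ε m := by
      intro m hm
      have hFp : Measurable fun ω => F ω * powHits r x₀ ω :=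
        hF.measurable'.mul (measurable_powHits hr x₀)
      have hvis := hQ.lintegral_visit_le x₀ m (hFw m hm)
      refine le_trans ?_ (add_le_add_right (hvis.trans (mul_le_mul_right (hFε m) _)) I)
      rw [← lintegral_add_left hFp]
      refine lintegral_mono fun ω => ?_
      simp only
      rw [tsum_first_visit]
      split_ifs with hv
      · rw [mul_one]; exact le_add_self
      · have hv' : ∀ k ≥ m, ω k ≠ x₀ := fun k hk hkx => hv ⟨k, hk, hkx⟩
        rw [powHits_eq_powHitsBefore hr.1.le hv', mul_zero, add_zero]
        exact mul_le_of_le_one_right' (indicator_le_self' (by simp) ω)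
    refine ge_of_tendsto (hlim (ENNReal.ofReal (φ x₀) + (B + c)) (ENNReal.add_ne_top.2
      ⟨ENNReal.ofReal_ne_top, ENNReal.add_ne_top.2 ⟨hB, h.const_ne_top⟩⟩) I) ?_
    filter_upwards [eventually_ge_atTop n] with m hm
    rw [add_mul, ← add_assoc]
    exact (hNR m hm).trans (add_le_add_left (hRI m hm) _)

end IsQ

end RecurrentChain

/-! ### Martin kernels, change of base point, and limits at the boundary. -/

namespace RecurrentChain

variable {E : Type*} [Countable E] [MeasurableSpace E] [DiscreteMeasurableSpace E]
  (C : RecurrentChain E)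

open Classical in
/-- The normalized Martin kernel with pole at a point of `E`. -/
def phiAt (β : E → ℝ) (x₀ y x : E) : ℝ := if x = x₀ then 0 else C.kernel x₀ x y / β x₀

/-- A Harnack inequality for the Green function. -/
theorem exists_green_le (o z : E) :
    ∃ M : ℝ≥0∞, M ≠ ∞ ∧ ∀ y, C.green o z y ≤ M * C.green o o y := by
  refine C.reachable_induction (S := fun z => ∃ M : ℝ≥0∞, M ≠ ∞ ∧
    ∀ y, C.green o z y ≤ M * C.green o o y) o ⟨1, by simp, by simp⟩ (fun x z hx hxz => ?_) z
  rcases eq_or_ne z o with rfl | hz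
  · exact ⟨1, by simp, by simp⟩
  obtain ⟨M, hM, hle⟩ := hx
  have hp0 : ENNReal.ofReal (C.p x z) ≠ 0 := by simpa using hxz
  refine ⟨(ENNReal.ofReal (C.p x z))⁻¹ * M,
    ENNReal.mul_ne_top (ENNReal.inv_ne_top.2 hp0) hM, fun y => ?_⟩
  have h1 : ENNReal.ofReal (C.p x z) * C.green o z y ≤ M * C.green o o y := by
    refine le_trans ?_ (hle y)
    conv_rhs => rw [C.green_eq_add_killedOp]
    rw [← C.killed_of_ne hz]
    exact le_add_of_le_right (ENNReal.le_tsum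
      (f := fun z => ENNReal.ofReal (C.killed o x z) * C.green o z y) z)
  calc C.green o z y = (ENNReal.ofReal (C.p x z))⁻¹ *
        (ENNReal.ofReal (C.p x z) * C.green o z y) := by
        rw [← mul_assoc, ENNReal.inv_mul_cancel hp0 ENNReal.ofReal_ne_top, one_mul]
    _ ≤ _ := by rw [mul_assoc]; gcongr

namespace IsStationary

variable {C} {β : E → ℝ}

/-- By the excursion formula the normalization becomes `β y`, which no longer involves the base
point; this makes kernels with different base points comparable. -/
theorem phiAt_eq (hβ : C.IsStationary β) [DecidableEq E] (x₀ y x : E) :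
    C.phiAt β x₀ y x = (if x = x₀ then 0 else C.green x₀ x y).toReal / β y := by
  have h1 := (hβ.pos x₀).ne'
  have h2 := (hβ.pos y).ne'
  rw [phiAt]
  split_ifs
  · simp
  · rw [kernel, hβ.toReal_green]
    field_simp

theorem phiAt_nonneg (hβ : C.IsStationary β) (x₀ y x : E) : 0 ≤ C.phiAt β x₀ y x := by
  classical
  rw [hβ.phiAt_eq]
  exact div_nonneg ENNReal.toReal_nonneg (hβ.1 y)

theorem phiAt_le (hβ : C.IsStationary β) (x₀ y x : E) :
    C.phiAt β x₀ y x ≤ (C.green x₀ y y).toReal / β y := by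
  classical
  rw [hβ.phiAt_eq]
  refine div_le_div_of_nonneg_right (ENNReal.toReal_mono (hβ.green_ne_top _ _ _) ?_) (hβ.1 y)
  split_ifs
  · exact zero_le
  · exact C.green_le_green_self x₀ x y

/-- The Laplacian of the normalized Martin kernel. -/
theorem tsum_p_mul_phiAt (hβ : C.IsStationary β) [DecidableEq E] {x₀ y : E} (hy : y ≠ x₀) (x : E) :
    ∑' z, C.p x z * C.phiAt β x₀ y z =
      C.phiAt β x₀ y x + (if x = x₀ then 1 / β x₀ else 0) - (if x = y then 1 / β y else 0) := by
  set f : E → ℝ≥0∞ := fun z => if z = x₀ then 0 else C.green x₀ z y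
  have hf : ∀ z, f z ≠ ∞ := fun z => by
    simp only [f]
    split_ifs
    · simp
    · exact hβ.green_ne_top _ _ _
  have h1 : ∑' z, C.p x z * C.phiAt β x₀ y z = (stepOp C.p f x).toReal / β y := by
    rw [C.toReal_stepOp hf, ← tsum_div_const]
    exact tsum_congr fun z => by rw [hβ.phiAt_eq, mul_div_assoc]
  have h2 : stepOp C.p f x = C.killedOp x₀ (fun z => C.green x₀ z y) x :=
    (C.stepOp_p_eq_killedOp (if_pos rfl) x).trans (C.killedOp_congr (fun z hz => if_neg hz) x)
  have h3 : (C.green x₀ x y).toReal = (if x = y then 1 else 0) + (stepOp C.p f x).toReal := by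
    rw [h2, C.green_eq_add_killedOp, ENNReal.toReal_add, pointIndicator]
    · congr 1
      split_ifs <;> simp
    · rw [pointIndicator]; split_ifs <;> simp
    · rw [← h2]; exact C.stepOp_ne_top hf x
  have h4 : (stepOp C.p f x).toReal =
      (C.green x₀ x y).toReal - (if x = y then 1 else 0) := by rw [h3]; ring
  have hβ0 := (hβ.pos x₀).ne'
  have hβy := (hβ.pos y).ne'
  rw [h1, h4, hβ.phiAt_eq]
  by_cases hx : x = x₀
  · subst hx
    simp only [if_true, hβ.toReal_green, if_neg hy.symm]
    field_simp
    simp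
  · simp only [if_neg hx]
    split_ifs <;> field_simp <;> ring

/-- Change of the base point in the normalized Martin kernel. -/
theorem phiAt_sub_eq (hβ : C.IsStationary β) {o x₀ y y' : E} (hyo : y ≠ o) (hy0 : y ≠ x₀)
    (hyo' : y' ≠ o) (hy0' : y' ≠ x₀) (x : E) :
    C.phiAt β x₀ y x = C.phiAt β o y x - C.phiAt β o y x₀ +
      (C.phiAt β x₀ y' x - C.phiAt β o y' x + C.phiAt β o y' x₀) := by
  classical
  have hzero : ∀ y, C.phiAt β x₀ y x₀ = 0 := fun y => if_pos rfl
  set B : E → E → ℝ := fun x₀ y => (C.green x₀ y y).toReal / β y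
  have hB : ∀ x₀ y x, |C.phiAt β x₀ y x| ≤ B x₀ y := fun x₀ y x => by
    rw [abs_of_nonneg (hβ.phiAt_nonneg _ _ _)]
    exact hβ.phiAt_le _ _ _
  -- The pole terms cancel between the two base points, so the Laplacian of the difference does not
  -- depend on the pole. Subtracting the same difference for `y'` leaves a bounded harmonic
  -- function, hence a constant.
  have key := C.eq_of_bounded_of_harmonic_off (o := x₀)
    (h := fun x => (C.phiAt β x₀ y x - C.phiAt β o y x) -
      (C.phiAt β x₀ y' x - C.phiAt β o y' x))
    (B := B x₀ y + B o y + (B x₀ y' + B o y')) (fun x => ?_) (fun x _ => ?_) x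
  · simp only [hzero] at key
    linarith
  · exact (abs_sub _ _).trans (add_le_add
      ((abs_sub _ _).trans (add_le_add (hB _ _ _) (hB _ _ _)))
      ((abs_sub _ _).trans (add_le_add (hB _ _ _) (hB _ _ _))))
  · simp only [mul_sub]
    rw [((C.summable_p_mul x _).sub (C.summable_p_mul x _)).tsum_sub
      ((C.summable_p_mul x _).sub (C.summable_p_mul x _)),
      (C.summable_p_mul x _).tsum_sub (C.summable_p_mul x _),
      (C.summable_p_mul x _).tsum_sub (C.summable_p_mul x _),
      hβ.tsum_p_mul_phiAt hy0, hβ.tsum_p_mul_phiAt hyo, hβ.tsum_p_mul_phiAt hy0',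
      hβ.tsum_p_mul_phiAt hyo']
    ring

/-- An infinite supremum would erase the corresponding term of the Martin distance, since division
by `∞` gives 0; Harnack excludes this. -/
theorem kernelSup_ne_top (hβ : C.IsStationary β) (o z : E) : C.kernelSup o z ≠ ∞ := by
  obtain ⟨M, hM, hle⟩ := C.exists_green_le o z
  refine ne_top_of_le_ne_top hM (iSup_le fun y => ?_)
  refine ENNReal.ofReal_le_of_le_toReal ?_
  have hpos : 0 < (C.green o o y).toReal := by
    rw [hβ.toReal_green]; exact div_pos (hβ.pos y) (hβ.pos o)
  rw [kernel, div_le_iff₀ hpos, ← ENNReal.toReal_mul]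
  exact ENNReal.toReal_mono (ENNReal.mul_ne_top hM (hβ.green_ne_top _ _ _)) (hle y)

theorem uniformContinuous_kernel (hβ : C.IsStationary β) {o : E} {w : E → ℝ} (hw : ∀ z, 0 < w z)
    (z : E) : UniformContinuous fun y : C.MartinSpace o w => C.kernel o z y := by
  classical
  set W : ℝ≥0∞ := ENNReal.ofReal (w z)
  set D : ℝ≥0∞ := C.kernelSup o z + 1
  have hW0 : W ≠ 0 := by simpa [W] using hw z
  have hWt : W ≠ ∞ := ENNReal.ofReal_ne_top
  have hD0 : D ≠ 0 := by simp [D]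
  have hDt : D ≠ ∞ := ENNReal.add_ne_top.2 ⟨hβ.kernelSup_ne_top o z, ENNReal.one_ne_top⟩
  have hK : D / W ≠ ∞ := ENNReal.div_ne_top hDt hW0
  refine LipschitzWith.uniformContinuous (K := (D / W).toNNReal) fun x y => ?_
  rw [ENNReal.coe_toNNReal hK, edist_dist, Real.dist_eq]
  set a : ℝ≥0∞ := ENNReal.ofReal |C.kernel o z x - C.kernel o z y|
  have h1 : W * (a / D) ≤ C.martinDist o w x y := by
    refine le_trans ?_ (ENNReal.le_tsum z)
    exact mul_le_mul_right (ENNReal.div_le_div_right le_self_add _) _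
  calc a = D / W * (W * (a / D)) := by
        rw [← mul_assoc, ENNReal.div_mul_cancel hW0 hWt, ENNReal.mul_div_cancel hD0 hDt]
    _ ≤ D / W * C.martinDist o w x y := mul_le_mul_right h1 _

variable {o : E} {w : E → ℝ} {α : C.MartinCompactification o w}

/-- The trace on `E` of the neighborhoods of a point of the Martin compactification. -/
abbrev traceFilter (α : C.MartinCompactification o w) : Filter (C.MartinSpace o w) :=
  comap ((↑) : C.MartinSpace o w → C.MartinCompactification o w) (𝓝 α)

instance (α : C.MartinCompactification o w) : (traceFilter α).NeBot :=
  UniformSpace.Completion.isDenseInducing_coe.comap_nhds_neBot α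

theorem eventually_ne (hα : α ∈ C.boundary o w) (z : E) :
    ∀ᶠ y : C.MartinSpace o w in traceFilter α, (y : E) ≠ z := by
  have h : α ≠ UniformSpace.Completion.coe' (α := C.MartinSpace o w) z :=
    fun h => hα ⟨z, h.symm⟩
  filter_upwards [preimage_mem_comap (isOpen_ne.mem_nhds h)] with y hy hyz
  exact hy (by rw [show y = z from hyz])

theorem exists_tendsto_kernel (hβ : C.IsStationary β) (hw : ∀ z, 0 < w z)
    (α : C.MartinCompactification o w) (z : E) :
    ∃ l, Tendsto (fun y : C.MartinSpace o w => C.kernel o z y) (traceFilter α) (𝓝 l) := by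
  have hu := hβ.uniformContinuous_kernel hw (o := o) z
  refine ⟨UniformSpace.Completion.extension (fun y : C.MartinSpace o w => C.kernel o z y) α, ?_⟩
  refine ((UniformSpace.Completion.continuous_extension.tendsto α).comp tendsto_comap).congr
    fun y => ?_
  exact UniformSpace.Completion.extension_coe hu y

/-- The Martin distance controls only the kernels based at `o`; the others are reached by changing
the base point with a fixed auxiliary pole `y'`. -/
theorem exists_tendsto_phiAt (hβ : C.IsStationary β) (hw : ∀ z, 0 < w z)
    (hα : α ∈ C.boundary o w) (x₀ x : E) :
    ∃ l, Tendsto (fun y : C.MartinSpace o w => C.phiAt β x₀ y x) (traceFilter α) (𝓝 l) := by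
  have h0 : ∀ x, ∃ l, Tendsto (fun y : C.MartinSpace o w => C.phiAt β o y x)
      (traceFilter α) (𝓝 l) := by
    intro x
    by_cases hx : x = o
    · exact ⟨0, by simp only [phiAt, if_pos hx]; exact tendsto_const_nhds⟩
    · obtain ⟨l, hl⟩ := hβ.exists_tendsto_kernel hw α x
      exact ⟨l / β o, by simp only [phiAt, if_neg hx]; exact hl.div_const _⟩
  obtain ⟨y', hyo', hy0'⟩ := ((eventually_ne hα o).and (eventually_ne hα x₀)).exists
  obtain ⟨l₁, hl₁⟩ := h0 x
  obtain ⟨l₂, hl₂⟩ := h0 x₀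
  refine ⟨_, ((hl₁.sub hl₂).add_const
    (C.phiAt β x₀ y' x - C.phiAt β o y' x + C.phiAt β o y' x₀)).congr' ?_⟩
  filter_upwards [eventually_ne hα o, eventually_ne hα x₀] with y hyo hy0
  exact (hβ.phiAt_sub_eq hyo hy0 hyo' hy0' x).symm

/-- `φ_{x₀, α}` is the limit of the normalized Martin kernels. -/
theorem tendsto_phiAt (hβ : C.IsStationary β) (hw : ∀ z, 0 < w z) (hα : α ∈ C.boundary o w)
    (x₀ x : E) : Tendsto (fun y : C.MartinSpace o w => C.phiAt β x₀ y x) (traceFilter α)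
      (𝓝 (C.phi β x₀ α x)) := by
  obtain ⟨l, hl⟩ := hβ.exists_tendsto_phiAt hw hα x₀ x
  by_cases hx : x = x₀
  · simp only [phiAt, phi, if_pos hx]
    exact tendsto_const_nhds
  · have hβ0 := (hβ.pos x₀).ne'
    have h1 : Tendsto (fun y : C.MartinSpace o w => C.kernel x₀ x y) (traceFilter α)
        (𝓝 (l * β x₀)) := by
      refine (hl.mul_const (β x₀)).congr fun y => ?_
      simp only [phiAt, if_neg hx]
      exact div_mul_cancel₀ _ hβ0
    -- `kernelExt` is meaningful only because the limit is already known to exist.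
    have h2 : C.kernelExt x₀ x α = l * β x₀ :=
      UniformSpace.Completion.isDenseInducing_coe.extend_eq_of_tendsto h1
    rw [phi, if_neg hx, h2, mul_div_cancel_right₀ _ hβ0]
    exact hl

theorem phi_nonneg (hβ : C.IsStationary β) (hw : ∀ z, 0 < w z) (hα : α ∈ C.boundary o w)
    (x₀ x : E) : 0 ≤ C.phi β x₀ α x :=
  ge_of_tendsto' (hβ.tendsto_phiAt hw hα x₀ x) fun y => hβ.phiAt_nonneg x₀ y x

/-- Rows are finite, so the Laplacian passes to the limit; the pole eventually differs from `x`, and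
its negative term disappears. -/
theorem tsum_p_mul_phi (hβ : C.IsStationary β) (hw : ∀ z, 0 < w z) (hα : α ∈ C.boundary o w)
    [DecidableEq E] (x₀ x : E) : ∑' z, C.p x z * C.phi β x₀ α z =
      C.phi β x₀ α x + if x = x₀ then 1 / β x₀ else 0 := by
  have hs : ∀ f : E → ℝ, ∑' z, C.p x z * f z = ∑ z ∈ (C.finite_jumps x).toFinset, C.p x z * f z :=
    fun f => tsum_eq_sum fun z hz => by
      have : C.p x z = 0 := by simpa using hz
      rw [this, zero_mul]
  have h1 : Tendsto (fun y : C.MartinSpace o w => ∑' z, C.p x z * C.phiAt β x₀ y z)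
      (traceFilter α) (𝓝 (∑' z, C.p x z * C.phi β x₀ α z)) := by
    simp_rw [hs]
    exact tendsto_finsetSum _ fun z _ => (hβ.tendsto_phiAt hw hα x₀ z).const_mul _
  refine tendsto_nhds_unique h1 (((hβ.tendsto_phiAt hw hα x₀ x).add_const
    (if x = x₀ then 1 / β x₀ else 0)).congr' ?_)
  filter_upwards [eventually_ne hα x₀, eventually_ne hα x] with y hy hyx
  rw [hβ.tsum_p_mul_phiAt hy, if_neg (show ¬ x = y from fun h => hyx h.symm), sub_zero]

theorem exists_abs_phi_sub_le (hβ : C.IsStationary β) (hw : ∀ z, 0 < w z)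
    (hα : α ∈ C.boundary o w) (x₀ : E) :
    ∃ B : ℝ, 0 ≤ B ∧ ∀ x, |C.phi β x₀ α x - C.phi β o α x| ≤ B := by
  obtain ⟨y', hyo', hy0'⟩ := ((eventually_ne hα o).and (eventually_ne hα x₀)).exists
  set K : E → ℝ := fun x => C.phiAt β x₀ y' x - C.phiAt β o y' x + C.phiAt β o y' x₀
  have hK : ∀ x, C.phi β x₀ α x = C.phi β o α x - C.phi β o α x₀ + K x := fun x => by
    refine tendsto_nhds_unique (hβ.tendsto_phiAt hw hα x₀ x)
      ((((hβ.tendsto_phiAt hw hα o x).sub (hβ.tendsto_phiAt hw hα o x₀)).add_const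
        (K x)).congr' ?_)
    filter_upwards [eventually_ne hα o, eventually_ne hα x₀] with y hyo hy0
    exact (hβ.phiAt_sub_eq hyo hy0 hyo' hy0' x).symm
  set B₁ := (C.green x₀ y' y').toReal / β y'
  set B₂ := (C.green o y' y').toReal / β y'
  have hle : ∀ x, |C.phi β x₀ α x - C.phi β o α x| ≤ C.phi β o α x₀ + B₁ + 2 * B₂ := by
    intro x
    have h1 := hβ.phiAt_nonneg x₀ y' x
    have h2 := hβ.phiAt_le x₀ y' x
    have h3 := hβ.phiAt_nonneg o y' x
    have h4 := hβ.phiAt_le o y' x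
    have h5 := hβ.phiAt_nonneg o y' x₀
    have h6 := hβ.phiAt_le o y' x₀
    have h7 := hβ.phi_nonneg hw hα o x₀
    rw [hK x, abs_le]
    constructor <;> simp only [K] <;> linarith
  exact ⟨_, (abs_nonneg _).trans (hle o), hle⟩

end IsStationary

end RecurrentChain

/-! ### The transform attached to a boundary point, and the conclusion. -/

namespace RecurrentChain

variable {E : Type*} [Countable E] [MeasurableSpace E] [DiscreteMeasurableSpace E]
  {C : RecurrentChain E} {β : E → ℝ} {o : E} {w : E → ℝ} {α : C.MartinCompactification o w} {r : ℝ}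

theorem psi_eq [DecidableEq E] (β : E → ℝ) (α : C.MartinCompactification o w) (r : ℝ) (x₀ x : E) :
    C.psi β x₀ α r x = C.phi β x₀ α x + r / (1 - r) / β x₀ := by
  rw [psi, phi]
  split_ifs <;> ring

theorem transformedTransition_eq [DecidableEq E] (β : E → ℝ) (α : C.MartinCompactification o w)
    (r : ℝ) (x₀ x y : E) : C.transformedTransition β x₀ α r x y =
      (if x = x₀ then r else 1) * (C.p x y * C.psi β x₀ α r y) / C.psi β x₀ α r x := by
  rw [transformedTransition]
  split_ifs with h
  · rw [h]; ring
  · ring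

namespace IsStationary

theorem const_pos (hβ : C.IsStationary β) (hr : r ∈ Ioo (0 : ℝ) 1) (x₀ : E) :
    0 < r / (1 - r) / β x₀ :=
  div_pos (div_pos hr.1 (sub_pos.2 hr.2)) (hβ.pos x₀)

theorem psi_pos (hβ : C.IsStationary β) (hw : ∀ z, 0 < w z) (hα : α ∈ C.boundary o w)
    (hr : r ∈ Ioo (0 : ℝ) 1) (x₀ x : E) : 0 < C.psi β x₀ α r x := by
  classical
  rw [psi_eq]
  exact add_pos_of_nonneg_of_pos (hβ.phi_nonneg hw hα x₀ x) (hβ.const_pos hr x₀)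

theorem ofReal_psi (hβ : C.IsStationary β) (hw : ∀ z, 0 < w z) (hα : α ∈ C.boundary o w)
    (hr : r ∈ Ioo (0 : ℝ) 1) (x₀ x : E) : ENNReal.ofReal (C.psi β x₀ α r x) =
      ENNReal.ofReal (C.phi β x₀ α x) + ENNReal.ofReal (r / (1 - r) / β x₀) := by
  classical
  rw [psi_eq, ENNReal.ofReal_add (hβ.phi_nonneg hw hα x₀ x) (hβ.const_pos hr x₀).le]

/-- The excess of `φ` at `x₀` is `1 / β x₀`, and the constant in `psi` is the solution of `r * (1 /
β x₀ + c) = c`. -/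
theorem isPotential (hβ : C.IsStationary β) (hw : ∀ z, 0 < w z) (hα : α ∈ C.boundary o w)
    (hr : r ∈ Ioo (0 : ℝ) 1) (x₀ : E) :
    C.IsPotential r x₀ (fun x => ENNReal.ofReal (C.phi β x₀ α x))
      (ENNReal.ofReal (r / (1 - r) / β x₀)) := by
  classical
  have hstep := C.stepOp_ofReal (hβ.phi_nonneg hw hα x₀)
  have h0 : C.phi β x₀ α x₀ = 0 := if_pos rfl
  refine ⟨fun _ => ENNReal.ofReal_ne_top, ?_, fun x hx => ?_, ?_, ENNReal.ofReal_ne_top, ?_⟩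
  · rw [h0, ENNReal.ofReal_zero]
  · rw [hstep, hβ.tsum_p_mul_phi hw hα, if_neg hx, add_zero]
  · simpa using hβ.const_pos hr x₀
  · have hβ0 := hβ.pos x₀
    have hr' : 0 < 1 - r := sub_pos.2 hr.2
    rw [hstep, hβ.tsum_p_mul_phi hw hα, if_pos rfl, h0, zero_add,
      ← ENNReal.ofReal_add (by positivity) (hβ.const_pos hr x₀).le, ← ENNReal.ofReal_mul hr.1.le]
    congr 1
    field_simp
    ring

theorem transformedTransition_nonneg (hβ : C.IsStationary β) (hw : ∀ z, 0 < w z)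
    (hα : α ∈ C.boundary o w) (hr : r ∈ Ioo (0 : ℝ) 1) (x₀ x y : E) :
    0 ≤ C.transformedTransition β x₀ α r x y := by
  classical
  rw [transformedTransition_eq]
  refine div_nonneg (mul_nonneg ?_ (mul_nonneg (C.p_nonneg x y)
    (hβ.psi_pos hw hα hr x₀ y).le)) (hβ.psi_pos hw hα hr x₀ x).le
  split_ifs
  · exact hr.1.le
  · exact zero_le_one

theorem hasSum_transformedTransition (hβ : C.IsStationary β) (hw : ∀ z, 0 < w z)
    (hα : α ∈ C.boundary o w) (hr : r ∈ Ioo (0 : ℝ) 1) (x₀ x : E) :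
    HasSum (C.transformedTransition β x₀ α r x) 1 := by
  classical
  have h1 : ∑' y, C.p x y * C.psi β x₀ α r y = C.phi β x₀ α x +
      (if x = x₀ then 1 / β x₀ else 0) + r / (1 - r) / β x₀ := by
    simp_rw [psi_eq, mul_add]
    rw [(C.summable_p_mul x _).tsum_add (C.summable_p_mul x fun _ => r / (1 - r) / β x₀),
      hβ.tsum_p_mul_phi hw hα, tsum_mul_right, C.tsum_p, one_mul]
  have h2 := (((C.summable_p_mul x (C.psi β x₀ α r)).hasSum.mul_left
    (if x = x₀ then r else 1)).div_const (C.psi β x₀ α r x))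
  have h3 : (if x = x₀ then r else 1) * (∑' y, C.p x y * C.psi β x₀ α r y) /
      C.psi β x₀ α r x = 1 := by
    rw [div_eq_one_iff_eq (hβ.psi_pos hw hα hr x₀ x).ne', h1, psi_eq]
    split_ifs with hx
    · have hβ0 := (hβ.pos x₀).ne'
      have hr' : 1 - r ≠ 0 := (sub_pos.2 hr.2).ne'
      rw [hx, show C.phi β x₀ α x₀ = 0 from if_pos rfl]
      field_simp
      ring
    · ring
  rw [h3] at h2
  simp_rw [← transformedTransition_eq] at h2
  exact h2

theorem psi_mul_transformedTransition (hβ : C.IsStationary β) (hw : ∀ z, 0 < w z)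
    (hα : α ∈ C.boundary o w) (hr : r ∈ Ioo (0 : ℝ) 1) (x₀ x y : E) :
    (ENNReal.ofReal (C.phi β x₀ α x) + ENNReal.ofReal (r / (1 - r) / β x₀)) *
        ENNReal.ofReal (C.transformedTransition β x₀ α r x y) =
      C.weighted r x₀ x y *
        (ENNReal.ofReal (C.phi β x₀ α y) + ENNReal.ofReal (r / (1 - r) / β x₀)) := by
  classical
  have h1 := hβ.psi_pos hw hα hr x₀ x
  rw [← hβ.ofReal_psi hw hα hr, ← hβ.ofReal_psi hw hα hr, ← ENNReal.ofReal_mul h1.le,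
    transformedTransition_eq, mul_div_cancel₀ _ h1.ne', weighted, mul_assoc,
    ← ENNReal.ofReal_mul (C.p_nonneg x y)]
  split_ifs
  · rw [ENNReal.ofReal_mul hr.1.le]
  · rw [one_mul, one_mul]

/-- The measure `Q^α_x` has the properties that characterize it. -/
theorem isQ_martinQ (hβ : C.IsStationary β) (hw : ∀ z, 0 < w z) (hα : α ∈ C.boundary o w) (x : E) :
    C.IsQ o (C.phi β o α) x (C.martinQ β α x) := by
  -- The properties `IsQ` do not involve `r`, so any value in (0, 1) serves for the construction.
  have hr : (1 / 2 : ℝ) ∈ Ioo (0 : ℝ) 1 := by constructor <;> norm_num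
  have h := (hβ.isPotential hw hα hr o).exists_isQ hr (hβ.green_ne_top o)
    (hβ.transformedTransition_nonneg hw hα hr o) (hβ.hasSum_transformedTransition hw hα hr o)
    (hβ.psi_mul_transformedTransition hw hα hr o) x
  rw [martinQ, Q, dif_pos h]
  exact h.choose_spec

/-- The transformed measure agrees with the Markov law on every `F_n`. -/
theorem lintegral_transformedLaw (hβ : C.IsStationary β) (hw : ∀ z, 0 < w z)
    (hα : α ∈ C.boundary o w) (hr : r ∈ Ioo (0 : ℝ) 1) (x₀ x : E) {μ : Measure (ℕ → E)}
    (hμ : IsMarkovLaw (C.transformedTransition β x₀ α r) x μ) (n : ℕ) {F : (ℕ → E) → ℝ≥0∞}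
    (hF : DependsOn F (Iic n)) (hF1 : ∀ ω, F ω ≤ 1) :
    ∫⁻ ω, F ω ∂(C.transformedLaw β x₀ α r x) = ∫⁻ ω, F ω ∂μ := by
  obtain ⟨B, hB0, hB⟩ := hβ.exists_abs_phi_sub_le hw hα x₀
  have h0 := hβ.phi_nonneg hw hα x₀
  have h0' := hβ.phi_nonneg hw hα o
  have key := (hβ.isQ_martinQ hw hα x).lintegral_powHits hr (hβ.isPotential hw hα hr x₀)
    (B := ENNReal.ofReal B) ENNReal.ofReal_ne_top
    (fun y => by
      rw [← ENNReal.ofReal_add (h0 y) hB0]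
      exact ENNReal.ofReal_le_ofReal (by linarith [(abs_le.1 (hB y)).1]))
    (fun y => by
      rw [← ENNReal.ofReal_add (h0' y) hB0]
      exact ENNReal.ofReal_le_ofReal (by linarith [(abs_le.1 (hB y)).2])) n hF hF1
  rw [← C.mul_lintegral_transform (hβ.transformedTransition_nonneg hw hα hr x₀)
    (hβ.psi_mul_transformedTransition hw hα hr x₀) hμ n hF, ← hβ.ofReal_psi hw hα hr] at key
  set ψ := ENNReal.ofReal (C.psi β x₀ α r x)
  have hψ0 : ψ ≠ 0 := by simpa [ψ] using hβ.psi_pos hw hα hr x₀ x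
  have hψt : ψ ≠ ∞ := ENNReal.ofReal_ne_top
  have hm := measurable_powHits (E := E) hr x₀
  have hFp : Measurable fun ω => F ω * powHits r x₀ ω := hF.measurable'.mul hm
  rw [transformedLaw, lintegral_withDensity_eq_lintegral_mul _ (hm.div_const ψ) hF.measurable']
  have h1 : ∀ ω, ((fun ω => powHits r x₀ ω / ψ) * F) ω = F ω * powHits r x₀ ω * ψ⁻¹ := fun ω => by
    simp only [Pi.mul_apply, div_eq_mul_inv]
    ring
  simp_rw [h1]
  rw [lintegral_mul_const _ hFp, key, mul_right_comm, ENNReal.mul_inv_cancel hψ0 hψt, one_mul]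

theorem isMarkovLaw_transformedLaw (hβ : C.IsStationary β) (hw : ∀ z, 0 < w z)
    (hα : α ∈ C.boundary o w) (hr : r ∈ Ioo (0 : ℝ) 1) (x₀ x : E) :
    IsMarkovLaw (C.transformedTransition β x₀ α r) x (C.transformedLaw β x₀ α r x) := by
  obtain ⟨μ, hμ⟩ := exists_isMarkovLaw (hβ.transformedTransition_nonneg hw hα hr x₀)
    (hβ.hasSum_transformedTransition hw hα hr x₀) x
  have := hμ.isProbabilityMeasure
  have hcyl : ∀ n y, C.transformedLaw β x₀ α r x (pathCylinder n y) = μ (pathCylinder n y) := by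
    intro n y
    have h := hβ.lintegral_transformedLaw hw hα hr x₀ x hμ n
      (dependsOn_indicator_pathCylinder n y) fun ω => indicator_le_self' (by simp) ω
    rwa [lintegral_indicator_one (measurableSet_pathCylinder n y),
      lintegral_indicator_one (measurableSet_pathCylinder n y)] at h
  refine ⟨⟨?_⟩, fun y₀ hy₀ => ?_, fun k y hy => (hcyl k y).trans (hμ.path k y hy)⟩
  -- Total mass one is the same identity with a constant test function.
  · have h := hβ.lintegral_transformedLaw hw hα hr x₀ x hμ 0 (F := fun _ => 1)
      (fun _ _ _ => rfl) fun _ => le_rfl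
    rwa [lintegral_one, lintegral_one, hμ.isProbabilityMeasure.measure_univ] at h
  · have h := (hcyl 0 fun _ => y₀).trans (hμ.measure_pathCylinder_of_ne 0 _ hy₀)
    simpa [pathCylinder] using h

end IsStationary

end RecurrentChain

end

theorem proposition4p2 {E : Type*} [Countable E] [MeasurableSpace E] [DiscreteMeasurableSpace E]
    (C : RecurrentChain E)
    (β : E → ℝ) (hβ : C.IsStationary β)
    (o : E) (w : E → ℝ) (hw_pos : ∀ z, 0 < w z) (hw : Summable w)
    (α : C.MartinCompactification o w) (hα : α ∈ C.minimalBoundary o w)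
    (r : ℝ) (hr : r ∈ Set.Ioo (0 : ℝ) 1) (x₀ : E) :
    (∀ x y, C.transformedTransition β x₀ α r x y ∈ Set.Icc (0 : ℝ) 1) ∧
    (∀ x, HasSum (C.transformedTransition β x₀ α r x) 1) ∧
    ∀ x, IsMarkovLaw (C.transformedTransition β x₀ α r) x (C.transformedLaw β x₀ α r x) := by
  have hnonneg := hβ.transformedTransition_nonneg hw_pos hα.1 hr x₀
  have hsum := hβ.hasSum_transformedTransition hw_pos hα.1 hr x₀
  exact ⟨fun x y => ⟨hnonneg x y, le_hasSum (hsum x) y fun z _ => hnonneg x z⟩, hsum,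
    hβ.isMarkovLaw_transformedLaw hw_pos hα.1 hr x₀⟩
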